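/- Let $\mathcal F$ be a holomorphic foliation of degree $d\ge 1$ on $\mathbb P^2=\mathbb P^2_{\mathbb C}$, given in homogeneous coordinates by a 1-form $\omega=\sum_{i=0}^{2}\omega_i\,dx_i$ whose coefficients are homogeneous of degree $d+1$, without common factor, and satisfy $\sum_i x_i\omega_i=0$. Let $\mathrm{Sing}(\mathcal F)$ be the set of common zeros of the $\omega_i$. For $p\in\mathbb P^2$ let $P_p^{\mathcal F}$ be the polar curve of $\mathcal F$ with center $p$, i.e. the curve of tangencies between $\mathcal F$ and the pencil of lines through $p$, with equation $\sum_i p_i\,\omega_i(x)=0$. A point $q\in\mathrm{Sing}(\mathcal F)$ is called quasi-radial if, after blowing up $q$, the exceptional divisor is not invariant by the strict transform of $\mathcal F$; let $\mathrm{Sing}_{QR}(\mathcal F)$ be the set of quasi-radial singularities. Then for a generic point $p\in\mathbb P^2$ (i.e. for every $p$ in the complement of some proper algebraic subset of $\mathbb P^2$) we have $p\notin\mathrm{Sing}(\mathcal F)$ and: 1. If $q\in\mathrm{Sing}(\mathcal F)$ is not quasi-radial, the tangent cone of $P_p^{\mathcal F}$ at $q$ does not contain the line $\overline{pq}$. 2.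 If $q\in\mathrm{Sing}(\mathcal F)$ is quasi-radial, the tangent cone of $P_p^{\mathcal F}$ at $q$ contains the line $\overline{pq}$ exactly once, i.e. with multiplicity one. 3. The number of quasi-radial singularities is finite and satisfies $$\#\mathrm{Sing}_{QR}(\mathcal F)\le \deg(\check P_p^{\mathcal F})-1,$$ where $\check P_p^{\mathcal F}\subset\check{\mathbb P}^2$ is the dual curve of $P_p^{\mathcal F}$, i.e. the Zariski closure of the set of its tangent lines at smooth points. -/

import Mathlib

open MvPolynomial
open scoped LinearAlgebra.Projectivization

noncomputable section

/-- The complex projective plane. A point `u` of the same space also stands for the line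
`∑ i, u i * x i = 0`, that is, for a point of the dual plane. -/
abbrev P2 : Type := ℙ ℂ (Fin 3 → ℂ)

/-- The ring of polynomials in the three homogeneous coordinates. -/
abbrev HPoly : Type := MvPolynomial (Fin 3) ℂ

/-- The zero set in the projective plane of a homogeneous polynomial. -/
def projZeros (f : HPoly) : Set P2 := {x | eval x.rep f = 0}

/-- `P` holds for a generic point of the plane: on the complement of a proper algebraic subset,
that is, outside the zero set of some nonzero homogeneous polynomial. -/
def ForGeneric (P : P2 → Prop) : Prop :=
  ∃ (G : HPoly) (n : ℕ), G.IsHomogeneous n ∧ G ≠ 0 ∧ ∀ p : P2, p ∉ projZeros G → P p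

/-- A holomorphic foliation of degree `d` on the projective plane: a global section of
`Ω¹ ⊗ O(d + 2)` with zero set of codimension at least two. In homogeneous coordinates it is a
1-form `∑ i, form i * dx_i` whose coefficients are homogeneous of degree `d + 1` and have no
common factor, and which annihilates the Euler (radial) vector field. -/
structure PlaneFoliation (d : ℕ) where
  form : Fin 3 → HPoly
  isHomogeneous : ∀ i, (form i).IsHomogeneous (d + 1)
  euler : ∑ i, X i * form i = 0
  codim_two : ∀ h : HPoly, (∀ i, h ∣ form i) → IsUnit h

/-- The pullback of the 1-form `∑ i, ω i * dx_i` by the polynomial map `φ` from the affine plane;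
`pullbackForm φ ω j` is the coefficient of the differential of the `j`-th coordinate. -/
def pullbackForm (φ : Fin 3 → MvPolynomial (Fin 2) ℂ) (ω : Fin 3 → HPoly) (j : Fin 2) :
    MvPolynomial (Fin 2) ℂ :=
  ∑ i, aeval φ (ω i) * pderiv j (φ i)

/-- A chart of the blow-up at the point `[q]`. When `q, u, v` is a basis, `(s, t) ↦ q + s u + t v`
is an affine chart of the plane centred at `[q]`, and this is its composite with the chart
`(x, y) ↦ (s, t) = (x, x y)` of the blow-up of the origin. The exceptional divisor is `x = 0`.
The other standard chart of the blow-up is obtained by exchanging `u` and `v`. -/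
def blowupChart (q u v : Fin 3 → ℂ) (i : Fin 3) : MvPolynomial (Fin 2) ℂ :=
  C (q i) + X 0 * C (u i) + X 0 * X 1 * C (v i)

/-- `η = η 0 dx + η 1 dy` defines the strict transform of the foliation given by `ω` in the chart
of the blow-up: the pullback of `ω`, divided by the largest possible power of the equation `x` of
the exceptional divisor. -/
def IsStrictTransform (ω : Fin 3 → HPoly) (q u v : Fin 3 → ℂ)
    (η : Fin 2 → MvPolynomial (Fin 2) ℂ) : Prop :=
  (∃ k : ℕ, ∀ j, pullbackForm (blowupChart q u v) ω j = X 0 ^ k * η j) ∧ ∃ j, ¬ X 0 ∣ η j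

namespace PlaneFoliation

variable {d : ℕ}

/-- The singular set: the zeros of the 1-form. -/
def sing (F : PlaneFoliation d) : Set P2 := {q | ∀ i, eval q.rep (F.form i) = 0}

/-- The exceptional divisor of the blow-up at `q` is invariant by the strict transform of `F`: in
every chart, the form `η 0 dx + η 1 dy` of the strict transform vanishes on vectors tangent to
`x = 0`, that is, `η 1` vanishes on `x = 0`. -/
def ExceptionalInvariant (F : PlaneFoliation d) (q : P2) : Prop :=
  ∀ u v : Fin 3 → ℂ, LinearIndependent ℂ ![q.rep, u, v] →
    ∃ η, IsStrictTransform F.form q.rep u v η ∧ X 0 ∣ η 1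

/-- A singular point is quasi-radial if the exceptional divisor of the blow-up at this point is
not invariant by the strict transform of the foliation. -/
def IsQuasiRadial (F : PlaneFoliation d) (q : P2) : Prop :=
  q ∈ F.sing ∧ ¬ F.ExceptionalInvariant q

/-- The equation of the polar curve with centre `p`, the curve of tangencies between `F` and the
radial foliation at `p`: for nonsingular `x`, the tangent line of `F` at `x` is
`{y | ∑ i, y i * form i x = 0}`, and `x` is on the polar curve when this line contains `p`.
(The wedge product of the 1-form of `F` and the 1-form `p × x` of the radial foliation at `p` has
coefficient vector `- (polar p) x`, so this is the equation of the tangency divisor.) -/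
def polar (F : PlaneFoliation d) (p : P2) : HPoly := ∑ i, C (p.rep i) * F.form i

end PlaneFoliation

/-- The lowest-degree nonzero homogeneous component of a polynomial (and `0` for `0`). -/
def initialForm (f : HPoly) : HPoly :=
  homogeneousComponent (sInf {m : ℕ | homogeneousComponent m f ≠ 0}) f

/-- The equation of the tangent cone at `q` of the plane curve `f = 0`, `f` homogeneous: the
initial form of `f (q + x)`. For a homogeneous `f` this initial form is invariant under
translation of `x` by multiples of `q`, so it is the usual tangent cone in an affine chart centred
at `q`, written as a divisor of the plane made of lines through `q`, with multiplicities. -/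
def tangentCone (f : HPoly) (q : P2) : HPoly :=
  initialForm (aeval (fun i => X i + C (q.rep i)) f)

/-- The linear form whose zero set is the line through two distinct points `p` and `q`. -/
def lineForm (p q : P2) : HPoly := ∑ i, C (crossProduct p.rep q.rep i) * X i

/-- The number of times that the tangent cone at `q` of the curve `f = 0` contains the line
through `p` and `q`. -/
def tangentConeMult (f : HPoly) (p q : P2) : ℕ∞ := emultiplicity (lineForm p q) (tangentCone f q)

/-- The Zariski closure of a subset of the projective plane. -/
def zariskiClosure (T : Set P2) : Set P2 :=
  {x | ∀ (f : HPoly) (n : ℕ), f.IsHomogeneous n → T ⊆ projZeros f → x ∈ projZeros f}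

/-- The tangent lines at smooth points of a plane curve `V`, as points of the dual plane. The
gradients at `x` of the homogeneous polynomials vanishing on `V` are all zero when `x` is a
singular point of the (reduced) curve `V`, and are the multiples of the coordinate vector of the
tangent line at `x` when `x` is a smooth point. -/
def tangentLines (V : Set P2) : Set P2 :=
  {l | ∃ x ∈ V, ∃ (f : HPoly) (n : ℕ), f.IsHomogeneous n ∧ V ⊆ projZeros f ∧
    ∃ h : (fun i => eval x.rep (pderiv i f)) ≠ 0, l = Projectivization.mk ℂ _ h}

/-- The dual curve: the closure, in the dual plane, of the set of tangent lines at smooth points. -/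
def dualCurve (V : Set P2) : Set P2 := zariskiClosure (tangentLines V)

/-- The algebraic subset `D` of the plane, of dimension at most one, has degree `n`: its
one-dimensional part has a reduced equation of degree `n`. (Isolated points, such as the dual of a
line, do not contribute.) -/
def HasCurveDegree (D : Set P2) (n : ℕ) : Prop :=
  ∃ f : HPoly, f.IsHomogeneous n ∧ Squarefree f ∧ projZeros f ⊆ D ∧ (D \ projZeros f).Finite

end

/-! Local part. Let `W` be the leading homogeneous part, of degree `k`, of `ω (q + x)`, and put `R =
∑ x_i W_i`. The lowest-degree part of the Euler relation gives `∑ q_i W_i = 0`. On the blow-up, the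
`dx`-coefficient of the pullback is `x^k (R + x ⋯)`, while the `dy`-coefficient is divisible by
`x^(k+1)`; hence the exceptional divisor is non-invariant exactly when `R = 0`
(`isQuasiRadial_iff`). For generic `p` the tangent cone of the polar at `q` is `∑ p_i W_i`, whose
value at `p` is `R p`. If `R ≠ 0`, any `p` with `R p ≠ 0` keeps the line `pq` out of the cone. If `R
= 0`, then `W` is orthogonal to both `x` and `q`, so `W = (x × q) H` (`exists_eq_crossProduct_mul`);
the cone is the line `pq` times `H`, and `H p ≠ 0` gives multiplicity one
(`forGeneric_tangentConeMult`).

Global part. The lines through `p` form a line in the dual plane, which meets a curve of degree `n`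
not containing it in at most `n` points. The lines `pq`, `q` quasi-radial, together with the tangent
line of the foliation at `p` (the source of the `1`), are distinct such points: each is a limit of
infinitely many tangent lines along a branch of the polar curve
(`eval_eq_zero_of_hasTransverseFactor`). The pencil at `p` is not contained in the dual curve
because no component of the polar is a line through `p` (`sum_pderiv_ne_zero_of_dvd_polarForm`),
which in turn holds because the tangent line at a generic point is not invariant
(`forGeneric_exists_tangent_polar_ne_zero`). -/

noncomputable section

/-! ### Homogeneous components and restriction to rays -/

section Homogeneous

variable {σ R : Type*} [CommRing R]

/-- Substitution of `T X i` for `X i`: the polynomial `∑ fₘ Tᵐ`, where `fₘ` are the homogeneous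
components of `f`. -/
def homogenize (σ R : Type*) [CommRing R] :
    MvPolynomial σ R →ₐ[R] Polynomial (MvPolynomial σ R) :=
  aeval fun i => Polynomial.C (X i) * Polynomial.X

lemma homogenize_monomial (s : σ →₀ ℕ) (r : R) :
    homogenize σ R (monomial s r) = Polynomial.C (monomial s r) * Polynomial.X ^ s.degree := by
  rw [homogenize, aeval_monomial, monomial_eq, map_mul, mul_assoc]
  congr 1
  simp only [Finsupp.prod, mul_pow, Finset.prod_mul_distrib, Finsupp.degree, map_prod, map_pow,
    Finset.prod_pow_eq_pow_sum]
  rfl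

lemma coeff_homogenize (f : MvPolynomial σ R) (m : ℕ) :
    (homogenize σ R f).coeff m = homogeneousComponent m f := by
  induction f using MvPolynomial.induction_on' with
  | add p q hp hq => simp [hp, hq]
  | monomial s r =>
    rw [homogenize_monomial, Polynomial.coeff_C_mul, Polynomial.coeff_X_pow,
      homogeneousComponent_of_mem (isHomogeneous_monomial (n := s.degree) r rfl)]
    split_ifs <;> simp

lemma homogenize_of_isHomogeneous {f : MvPolynomial σ R} {n : ℕ} (hf : f.IsHomogeneous n) :
    homogenize σ R f = Polynomial.C f * Polynomial.X ^ n := by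
  ext1 m
  rw [coeff_homogenize, homogeneousComponent_of_mem hf, Polynomial.coeff_C_mul,
    Polynomial.coeff_X_pow]
  split_ifs <;> simp

lemma eval_one_homogenize (f : MvPolynomial σ R) : (homogenize σ R f).eval 1 = f := by
  induction f using MvPolynomial.induction_on' with
  | add p q hp hq => simp [hp, hq]
  | monomial s r => simp [homogenize_monomial]

/-- The restriction of `f` to the line through the origin and `z`. -/
def restrictRay (z : σ → R) : MvPolynomial σ R →ₐ[R] Polynomial R :=
  aeval fun i => Polynomial.C (z i) * Polynomial.X

lemma restrictRay_eq (z : σ → R) (f : MvPolynomial σ R) :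
    restrictRay z f = (homogenize σ R f).map (eval z) := by
  induction f using MvPolynomial.induction_on with
  | C a => simp [restrictRay, homogenize, Polynomial.algebraMap_apply]
  | add p q hp hq => simp [hp, hq]
  | mul_X p i hp => simp [hp]; simp [restrictRay, homogenize]

lemma coeff_restrictRay (z : σ → R) (f : MvPolynomial σ R) (m : ℕ) :
    (restrictRay z f).coeff m = eval z (homogeneousComponent m f) := by
  rw [restrictRay_eq, Polynomial.coeff_map, coeff_homogenize]

lemma eval_restrictRay (z : σ → R) (f : MvPolynomial σ R) (t : R) :
    (restrictRay z f).eval t = eval (t • z) f := by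
  induction f using MvPolynomial.induction_on with
  | C a => simp [restrictRay]
  | add p q hp hq => simp [hp, hq]
  | mul_X p i hp => rw [map_mul, Polynomial.eval_mul, hp]; simp [restrictRay, mul_comm t]

lemma MvPolynomial.IsHomogeneous.eval_smul {f : MvPolynomial σ R} {n : ℕ} (hf : f.IsHomogeneous n)
    (t : R) (z : σ → R) : eval (t • z) f = t ^ n * eval z f := by
  rw [← eval_restrictRay, restrictRay_eq, homogenize_of_isHomogeneous hf]
  simp [mul_comm (t ^ n)]

/-- On the ray through `z`, `f` is a polynomial in `t` whose coefficients are the values at `z` of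
the components of `f`; infinitely many zeros make it zero. -/
lemma eval_homogeneousComponent_eq_zero [IsDomain R] [Infinite R] {f : MvPolynomial σ R}
    {z : σ → R} (h : ∀ t : R, t ≠ 0 → eval (t • z) f = 0) (m : ℕ) :
    eval z (homogeneousComponent m f) = 0 := by
  have : restrictRay z f = 0 := by
    apply Polynomial.eq_zero_of_infinite_isRoot
    refine (Set.finite_singleton (0 : R)).infinite_compl.mono fun t ht => ?_
    simpa [eval_restrictRay] using h t ht
  rw [← coeff_restrictRay, this, Polynomial.coeff_zero]

/-- Top and lowest degrees in the auxiliary variable are both additive on products. They agree for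
the product, so they agree for each factor. -/
lemma MvPolynomial.IsHomogeneous.of_dvd [IsDomain R] {f g : MvPolynomial σ R} {n : ℕ}
    (hf : f.IsHomogeneous n) (h0 : f ≠ 0) (hg : g ∣ f) : ∃ m ≤ n, g.IsHomogeneous m := by
  obtain ⟨h, rfl⟩ := hg
  have hg0 : g ≠ 0 := left_ne_zero_of_mul h0
  have hh0 : h ≠ 0 := right_ne_zero_of_mul h0
  have inj : ∀ a : MvPolynomial σ R, a ≠ 0 → homogenize σ R a ≠ 0 := fun a ha h => ha <| by
    rw [← eval_one_homogenize a, h, Polynomial.eval_zero]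
  have key := homogenize_of_isHomogeneous hf
  have h1 : (homogenize σ R g).natDegree + (homogenize σ R h).natDegree = n := by
    rw [← Polynomial.natDegree_mul (inj g hg0) (inj h hh0), ← map_mul, key,
      Polynomial.natDegree_C_mul_X_pow _ _ h0]
  have h2 : (homogenize σ R g).natTrailingDegree + (homogenize σ R h).natTrailingDegree = n := by
    rw [← Polynomial.natTrailingDegree_mul (inj g hg0) (inj h hh0), ← map_mul, key,
      Polynomial.C_mul_X_pow_eq_monomial, Polynomial.natTrailingDegree_monomial h0]
  have h3 := Polynomial.natTrailingDegree_le_natDegree (homogenize σ R g)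
  have h4 := Polynomial.natTrailingDegree_le_natDegree (homogenize σ R h)
  refine ⟨(homogenize σ R g).natDegree, by omega, ?_⟩
  have h5 : homogenize σ R g =
      Polynomial.C ((homogenize σ R g).coeff (homogenize σ R g).natDegree) *
        Polynomial.X ^ (homogenize σ R g).natDegree := by
    ext1 m
    rw [Polynomial.coeff_C_mul, Polynomial.coeff_X_pow]
    split_ifs with hm
    · rw [hm, mul_one]
    · rw [mul_zero]
      rcases lt_or_gt_of_ne hm with hm | hm
      · exact Polynomial.coeff_eq_zero_of_lt_natTrailingDegree (by omega)
      · exact Polynomial.coeff_eq_zero_of_natDegree_lt hm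
  have h6 := congrArg (Polynomial.eval 1) h5
  rw [eval_one_homogenize, Polynomial.eval_mul, Polynomial.eval_C, Polynomial.eval_pow,
    Polynomial.eval_X, one_pow, mul_one, coeff_homogenize] at h6
  have h7 := homogeneousComponent_isHomogeneous (homogenize σ R g).natDegree g
  rwa [← h6] at h7

lemma exists_homogeneousComponent_ne_zero {f : MvPolynomial σ R} (hf : f ≠ 0) :
    ∃ m, homogeneousComponent m f ≠ 0 := by
  by_contra! h
  exact hf ((sum_homogeneousComponent f).symm.trans (Finset.sum_eq_zero fun m _ => h m))

end Homogeneous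

/-! ### Algebraic dependence, linear forms, and cross products -/

/-- A nonzero polynomial in three variables divides a nontrivial polynomial expression in any three
given polynomials: the corresponding surface has transcendence degree two. -/
lemma exists_dvd_aeval {f : HPoly} (hf : f ≠ 0) (a : Fin 3 → HPoly) :
    ∃ G : HPoly, G ≠ 0 ∧ f ∣ aeval a G := by
  have hdep : ¬ AlgebraicIndependent ℂ (Fin.cons f a : Fin 4 → HPoly) := fun h => by
    have := h.cardinalMk_le_trdeg
    rw [MvPolynomial.trdeg_of_isDomain] at this
    simp only [Cardinal.mk_fin, Cardinal.lift_natCast, Nat.cast_le] at this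
    omega
  rw [algebraicIndependent_iff] at hdep
  push Not at hdep
  obtain ⟨P, hP, hP0⟩ := hdep
  -- Since `f ≠ 0`, powers of the variable standing for `f` can be cancelled from the relation. Its
  -- constant term in that variable is then nonzero, and serves as `G`.
  have hfin : FiniteMultiplicity (X 0 : MvPolynomial (Fin 4) ℂ) P :=
    FiniteMultiplicity.of_prime_left (MvPolynomial.X_prime) hP0
  obtain ⟨Q, hQ, hQ0⟩ := hfin.exists_eq_pow_mul_and_not_dvd
  have hQf : aeval (Fin.cons f a : Fin 4 → HPoly) Q = 0 := by
    rw [hQ, map_mul, map_pow, aeval_X, Fin.cons_zero] at hP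
    exact (mul_eq_zero.mp hP).resolve_left (pow_ne_zero _ hf)
  have hcoe : ∀ p : MvPolynomial (Fin 4) ℂ, aeval (Fin.cons f a : Fin 4 → HPoly) p =
      (Polynomial.aeval f) (((finSuccEquiv ℂ 3 p).map (aeval a : HPoly →ₐ[ℂ] HPoly).toRingHom)) := by
    intro p
    induction p using MvPolynomial.induction_on with
    | C c =>
      rw [← algebraMap_eq, AlgEquiv.commutes, AlgHom.commutes, algebraMap_eq,
        Polynomial.algebraMap_apply, Polynomial.map_C, Polynomial.aeval_C]
      exact (aeval_C a c).symm
    | add p q hp hq => rw [map_add, hp, hq, map_add, Polynomial.map_add, map_add]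
    | mul_X p i hp =>
      rw [map_mul, hp, map_mul, Polynomial.map_mul, map_mul]
      congr 1
      refine Fin.cases ?_ (fun j => ?_) i
      · simp [finSuccEquiv_X_zero]
      · simp [finSuccEquiv_X_succ]
  refine ⟨(finSuccEquiv ℂ 3 Q).coeff 0, fun h0 => hQ0 ?_, ?_⟩
  · obtain ⟨r, hr⟩ := Polynomial.X_dvd_iff.mpr h0
    refine ⟨(finSuccEquiv ℂ 3).symm r, (finSuccEquiv ℂ 3).injective ?_⟩
    rw [hr, map_mul, finSuccEquiv_X_zero, AlgEquiv.apply_symm_apply]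
  · rw [hcoe] at hQf
    set S := (finSuccEquiv ℂ 3 Q).map (aeval a : HPoly →ₐ[ℂ] HPoly).toRingHom with hS
    have h1 := Polynomial.divX_mul_X_add S
    rw [← h1] at hQf
    have h2 : S.coeff 0 = aeval a ((finSuccEquiv ℂ 3 Q).coeff 0) := by
      rw [hS, Polynomial.coeff_map]; rfl
    rw [← h2]
    simp only [map_add, map_mul, Polynomial.aeval_X, Polynomial.aeval_C, Algebra.algebraMap_self,
      RingHom.id_apply] at hQf
    exact ⟨-(Polynomial.aeval f S.divX), by linear_combination hQf⟩

/-- The linear form `∑ i, c i * x i`. -/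
def linForm (c : Fin 3 → ℂ) : HPoly := ∑ i, C (c i) * X i

@[simp] lemma eval_linForm (c x : Fin 3 → ℂ) : eval x (linForm c) = c ⬝ᵥ x := by
  simp [linForm, dotProduct]

lemma linForm_isHomogeneous (c : Fin 3 → ℂ) : (linForm c).IsHomogeneous 1 :=
  IsHomogeneous.sum _ _ _ fun _ _ => isHomogeneous_C_mul_X _ _

lemma linForm_ne_zero {c : Fin 3 → ℂ} (hc : c ≠ 0) : linForm c ≠ 0 := fun h => hc <| by
  ext i
  have := congrArg (eval (Pi.single i 1)) h
  simpa using this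

lemma linForm_irreducible {c : Fin 3 → ℂ} (hc : c ≠ 0) : Irreducible (linForm c) := by
  have h0 := linForm_ne_zero hc
  refine irreducible_of_totalDegree_eq_one ((linForm_isHomogeneous c).totalDegree h0) fun x hx => ?_
  refine isUnit_iff_ne_zero.mpr fun hx0 => h0 ?_
  ext m
  simpa [hx0] using hx m

/-- Two independent lines pass through `s`. An irreducible `P` dividing both would be associated to
each of them. -/
lemma exists_linForm_not_dvd {P : HPoly} (hP : Irreducible P) {s : Fin 3 → ℂ} (hs : s ≠ 0) :
    ∃ c : Fin 3 → ℂ, c ⬝ᵥ s = 0 ∧ ¬ P ∣ linForm c := by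
  have key : ∀ c c' y : Fin 3 → ℂ, c ⬝ᵥ s = 0 → c' ⬝ᵥ s = 0 → c ≠ 0 → c ⬝ᵥ y = 0 →
      c' ⬝ᵥ y ≠ 0 → ∃ c : Fin 3 → ℂ, c ⬝ᵥ s = 0 ∧ ¬ P ∣ linForm c := by
    intro c c' y h1 h2 hc h3 h4
    by_contra! h
    obtain ⟨a, ha⟩ := ((hP.associated_of_dvd (linForm_irreducible hc) (h c h1)).symm.dvd).trans
      (h c' h2)
    have := congrArg (eval y) ha
    simp [h3] at this
    exact h4 this
  obtain ⟨k, hk⟩ := Function.ne_iff.mp hs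
  simp only [Pi.zero_apply] at hk
  have hk' := neg_ne_zero.mpr hk
  fin_cases k
  · refine key ![s 1, -s 0, 0] ![s 2, 0, -s 0] ![0, 0, 1] ?_ ?_ (fun h => hk' (congrFun h 1)) ?_ ?_
    all_goals simp_all [dotProduct, Fin.sum_univ_three, mul_comm]
  · refine key ![-s 1, s 0, 0] ![0, s 2, -s 1] ![0, 0, 1] ?_ ?_ (fun h => hk' (congrFun h 0)) ?_ ?_
    all_goals simp_all [dotProduct, Fin.sum_univ_three, mul_comm]
  · refine key ![-s 2, 0, s 0] ![0, -s 2, s 1] ![0, 1, 0] ?_ ?_ (fun h => hk' (congrFun h 0)) ?_ ?_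
    all_goals simp_all [dotProduct, Fin.sum_univ_three, mul_comm]

/-- A triple of polynomials orthogonal to `x` and to a fixed vector `q ≠ 0` is a multiple of
`x × q`. -/
lemma exists_eq_crossProduct_mul {q : Fin 3 → ℂ} (hq : q ≠ 0) {W : Fin 3 → HPoly}
    (hqW : ∑ i, C (q i) * W i = 0) (hXW : ∑ i, X i * W i = 0) :
    ∃ H : HPoly, ∀ i, W i = crossProduct (fun i => (X i : HPoly)) (fun i => C (q i)) i * H := by
  set L : Fin 3 → HPoly := crossProduct (fun i => (X i : HPoly)) (fun i => C (q i)) with hL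
  have hcomm : ∀ i j, L i * W j = L j * W i := by
    rw [Fin.sum_univ_three] at hqW hXW
    have h01 : L 0 * W 1 = L 1 * W 0 := by
      simp only [hL, cross_apply, Matrix.cons_val]
      linear_combination X 2 * (-hqW) + C (q 2) * hXW
    have h02 : L 0 * W 2 = L 2 * W 0 := by
      simp only [hL, cross_apply, Matrix.cons_val]
      linear_combination X 1 * hqW - C (q 1) * hXW
    have h12 : L 1 * W 2 = L 2 * W 1 := by
      simp only [hL, cross_apply, Matrix.cons_val]
      linear_combination X 0 * (-hqW) + C (q 0) * hXW
    clear_value L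
    clear hqW hXW
    intro i j
    fin_cases i <;> fin_cases j
    exacts [rfl, h01, h02, h01.symm, rfl, h12, h02.symm, h12.symm, rfl]
  -- By `hcomm`, `L i` divides `L j * W i`; if `L i` is prime and does not divide `L j`, it divides
  -- `W i`, and the quotient is the common factor.
  suffices h : ∃ i j, Irreducible (L i) ∧ ¬ L i ∣ L j by
    obtain ⟨i, j, hi, hij⟩ := h
    have h1 : L i ∣ L j * W i := ⟨W j, (hcomm i j).symm⟩
    obtain ⟨H, hH⟩ := (hi.prime.dvd_or_dvd h1).resolve_left hij
    refine ⟨H, fun m => mul_left_cancel₀ hi.ne_zero ?_⟩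
    rw [hcomm, hH]; ring
  have key : ∀ (i j : Fin 3) (c y : Fin 3 → ℂ), linForm c = L i → c ≠ 0 → c ⬝ᵥ y = 0 →
      eval y (L j) ≠ 0 → ∃ i j, Irreducible (L i) ∧ ¬ L i ∣ L j := by
    rintro i j c y h1 h2 h3 h4
    refine ⟨i, j, h1 ▸ linForm_irreducible h2, fun ⟨a, ha⟩ => h4 ?_⟩
    rw [ha, ← h1, map_mul, eval_linForm, h3, zero_mul]
  obtain ⟨k, hk⟩ := Function.ne_iff.mp hq
  simp only [Pi.zero_apply] at hk
  have hk' := neg_ne_zero.mpr hk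
  fin_cases k
  · refine key 1 2 ![-q 2, 0, q 0] ![0, 1, 0] ?_ (fun h => hk (congrFun h 2)) ?_ ?_
    all_goals simp_all [linForm, dotProduct, Fin.sum_univ_three, cross_apply]
    ring
  · refine key 2 0 ![q 1, -q 0, 0] ![0, 0, 1] ?_ (fun h => hk (congrFun h 0)) ?_ ?_
    all_goals simp_all [linForm, dotProduct, Fin.sum_univ_three, cross_apply]
    ring
  · refine key 0 1 ![0, q 2, -q 1] ![1, 0, 0] ?_ (fun h => hk (congrFun h 1)) ?_ ?_
    all_goals simp_all [linForm, dotProduct, Fin.sum_univ_three, cross_apply]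
    ring

lemma eval_aeval_eq {σ τ : Type*} (a : σ → MvPolynomial τ ℂ) (z : τ → ℂ) (f : MvPolynomial σ ℂ) :
    eval z (aeval a f) = eval (fun i => eval z (a i)) f := by
  induction f using MvPolynomial.induction_on with
  | C c => rw [aeval_C, algebraMap_eq, eval_C, eval_C]
  | add p q hp hq => simp only [map_add, hp, hq]
  | mul_X p i hp => simp only [map_mul, hp, aeval_X, eval_X]

lemma polynomial_eval_aeval {σ : Type*} (a : σ → Polynomial ℂ) (b : ℂ) (f : MvPolynomial σ ℂ) :
    (aeval a f).eval b = eval (fun i => (a i).eval b) f := by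
  induction f using MvPolynomial.induction_on with
  | C c => simp
  | add p q hp hq => simp only [map_add, Polynomial.eval_add, hp, hq]
  | mul_X p i hp => simp only [map_mul, Polynomial.eval_mul, hp, aeval_X, eval_X]

/-! ### Plane curves: intersections, Nullstellensatz, Zariski closure, reduced equations -/

section Projective

lemma mk_mem_projZeros {f : HPoly} {n : ℕ} (hf : f.IsHomogeneous n) {v : Fin 3 → ℂ} (hv : v ≠ 0) :
    (Projectivization.mk ℂ v hv : P2) ∈ projZeros f ↔ eval v f = 0 := by
  obtain ⟨a, ha⟩ := Projectivization.exists_smul_eq_mk_rep ℂ v hv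
  rw [projZeros, Set.mem_ofPred_eq, ← ha, Units.smul_def, hf.eval_smul]
  simp

lemma mk_eq_mk_of_cross_eq_zero {v w : Fin 3 → ℂ} (hv : v ≠ 0) (hw : w ≠ 0)
    (h : crossProduct v w = 0) : (Projectivization.mk ℂ v hv : P2) = Projectivization.mk ℂ w hw := by
  by_contra hne
  rw [Projectivization.mk_eq_mk_iff'] at hne
  refine (crossProduct_ne_zero_iff_linearIndependent.mpr ?_) h
  rw [LinearIndependent.pair_symm_iff, LinearIndependent.pair_iff' hw]
  exact fun a ha => hne ⟨a, ha⟩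

lemma eq_of_cross_rep_eq_zero {p q : P2} (h : crossProduct p.rep q.rep = 0) : p = q := by
  rw [← p.mk_rep, ← q.mk_rep]
  exact mk_eq_mk_of_cross_eq_zero _ _ h

lemma X_two_dvd_sub (Q : HPoly) : X 2 ∣ Q - aeval ![(X 0 : HPoly), X 1, 0] Q := by
  rw [← Ideal.mem_span_singleton, ← Ideal.Quotient.mk_eq_mk_iff_sub_mem]
  induction Q using MvPolynomial.induction_on with
  | C a => simp
  | add p q hp hq => simp only [map_add] at *; rw [hp, hq]
  | mul_X p i hp =>
    simp only [map_mul] at *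
    rw [hp, aeval_X]
    congr 1
    fin_cases i
    · rfl
    · rfl
    · simp

/-- A substitute for the resultant: a relation among `X i`, `X j`, `g` modulo `f`, freed of factors
of the third variable, remains nonzero after setting `g = 0`. It then constrains `X j` on the common
zeros with `X i = 1`. -/
lemma exists_elimination {f g : HPoly} {m n : ℕ} (hf : f.IsHomogeneous m) (hg : g.IsHomogeneous n)
    (hirr : Irreducible f) (hfg : ¬ f ∣ g) (i j : Fin 3) :
    ∃ h : Polynomial ℂ, h ≠ 0 ∧ ∀ x : Fin 3 → ℂ, x i = 1 → eval x f = 0 → eval x g = 0 →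
      h.eval (x j) = 0 := by
  obtain ⟨P, hP0, hP⟩ := exists_dvd_aeval hirr.ne_zero ![X i, X j, g]
  have hfin : FiniteMultiplicity (X 2 : HPoly) P :=
    FiniteMultiplicity.of_prime_left (MvPolynomial.X_prime) hP0
  obtain ⟨Q, hQ, hQ0⟩ := hfin.exists_eq_pow_mul_and_not_dvd
  rw [hQ, map_mul, map_pow, aeval_X] at hP
  have hfQ : f ∣ aeval ![X i, X j, g] Q :=
    (hirr.prime.dvd_or_dvd hP).resolve_left fun h => hfg (hirr.prime.dvd_of_dvd_pow h)
  set Q' := aeval ![(X 0 : HPoly), X 1, 0] Q with hQ'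
  have hQ'0 : Q' ≠ 0 := fun h => hQ0 (by
    have := X_two_dvd_sub Q
    rwa [← hQ', h, sub_zero] at this)
  have hQ'eval : ∀ z : Fin 3 → ℂ, eval z Q' = eval ![z 0, z 1, 0] Q := by
    intro z
    rw [hQ', eval_aeval_eq]
    congr 2 with k
    fin_cases k <;> simp
  obtain ⟨l, hl⟩ := exists_homogeneousComponent_ne_zero hQ'0
  obtain ⟨z, hz⟩ : ∃ z, eval z (homogeneousComponent l Q' * X 0) ≠ 0 := by
    by_contra! h
    exact mul_ne_zero hl (X_ne_zero 0) (MvPolynomial.funext fun z => by simpa using h z)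
  rw [map_mul, eval_X] at hz
  have hz0 : z 0 ≠ 0 := right_ne_zero_of_mul hz
  -- `Q'` does not involve the third variable; fixing that variable at `z 2 / z 0` lets nonvanishing
  -- at `z` be carried over by rescaling.
  refine ⟨aeval ![1, Polynomial.X, Polynomial.C ((z 0)⁻¹ * z 2)] (homogeneousComponent l Q'), ?_, ?_⟩
  all_goals
    have hev : ∀ b : ℂ, Polynomial.eval b (aeval ![1, Polynomial.X, Polynomial.C ((z 0)⁻¹ * z 2)]
        (homogeneousComponent l Q')) = eval ![1, b, (z 0)⁻¹ * z 2] (homogeneousComponent l Q') := by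
      intro b
      rw [polynomial_eval_aeval]
      congr 2 with k
      fin_cases k <;> simp
  · intro h
    have h1 := hev ((z 0)⁻¹ * z 1)
    have h2 : ![1, (z 0)⁻¹ * z 1, (z 0)⁻¹ * z 2] = (z 0)⁻¹ • z := by
      ext k; fin_cases k <;> simp [hz0]
    rw [h, Polynomial.eval_zero, h2, (homogeneousComponent_isHomogeneous l Q').eval_smul] at h1
    simp [hz0] at h1
    exact left_ne_zero_of_mul hz h1
  · intro x hxi hxf hxg
    rw [hev]
    apply eval_homogeneousComponent_eq_zero
    intro t _
    rw [hQ'eval]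
    obtain ⟨a, ha⟩ := hfQ
    have h1 := congrArg (eval (t • x)) ha
    rw [map_mul, hf.eval_smul, hxf, mul_zero, zero_mul] at h1
    rw [eval_aeval_eq] at h1
    refine Eq.trans ?_ h1
    congr 2 with k
    fin_cases k <;> simp [hg.eval_smul, hxg, hxi]

lemma finite_projZeros_inter {f g : HPoly} {m n : ℕ} (hf : f.IsHomogeneous m)
    (hg : g.IsHomogeneous n) (hirr : Irreducible f) (hfg : ¬ f ∣ g) :
    (projZeros f ∩ projZeros g).Finite := by
  choose h h0 hh using exists_elimination hf hg hirr hfg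
  have hcov : projZeros f ∩ projZeros g ⊆
      ⋃ i : Fin 3, {p | p.rep i ≠ 0 ∧ p ∈ projZeros f ∩ projZeros g} := by
    intro p hp
    obtain ⟨i, hi⟩ := Function.ne_iff.mp p.rep_nonzero
    exact Set.mem_iUnion.mpr ⟨i, hi, hp⟩
  refine (Set.finite_iUnion fun i => ?_).subset hcov
  refine Set.Finite.of_injOn (f := fun p : P2 => (p.rep i)⁻¹ • p.rep)
    (t := {x | ∀ j, x j ∈ {b | (h i j).IsRoot b}}) ?_ ?_ ?_
  · rintro p ⟨hi, hpf, hpg⟩ j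
    refine hh i j _ ?_ ?_ ?_
    · simp [hi]
    · rw [hf.eval_smul, hpf, mul_zero]
    · rw [hg.eval_smul, hpg, mul_zero]
  · rintro p ⟨hp, -⟩ q ⟨hq, -⟩ hpq
    apply eq_of_cross_rep_eq_zero
    have hpq' : (p.rep i)⁻¹ • p.rep = (q.rep i)⁻¹ • q.rep := hpq
    have h1 : p.rep = (p.rep i * (q.rep i)⁻¹) • q.rep := by
      rw [mul_smul, ← hpq', smul_smul, mul_inv_cancel₀ hp, one_smul]
    rw [h1]
    simp
  · exact Set.Finite.pi' fun j => Polynomial.finite_setOfPred_isRoot (h0 i j)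

lemma dvd_of_forall_eval_eq_zero {P g : HPoly} (hP : Irreducible P)
    (h : ∀ x, eval x P = 0 → eval x g = 0) : P ∣ g := by
  have hprime : (Ideal.span {P}).IsPrime :=
    (Ideal.span_singleton_prime hP.ne_zero).mpr hP.prime
  rw [← Ideal.mem_span_singleton, ← IsPrime.vanishingIdeal_zeroLocus (K := ℂ) (Ideal.span {P}),
    mem_vanishingIdeal_iff]
  intro x hx
  rw [mem_zeroLocus_iff] at hx
  exact h x (hx P (Ideal.mem_span_singleton_self P))

lemma dvd_of_projZeros_subset {P g : HPoly} {m n : ℕ} (hPh : P.IsHomogeneous m)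
    (hg : g.IsHomogeneous n) (hP : Irreducible P) (h : projZeros P ⊆ projZeros g) : P ∣ g := by
  -- The origin is not a projective point; the factor `X i` makes the product vanish there too.
  have h1 : ∀ i, P ∣ X i * g := by
    refine fun i => dvd_of_forall_eval_eq_zero hP fun x hx => ?_
    by_cases hx0 : x = 0
    · simp [hx0]
    · have := (mk_mem_projZeros hg hx0).mp (h ((mk_mem_projZeros hPh hx0).mpr hx))
      simp [this]
  by_contra hPg
  have h2 : ∀ i, P ∣ X i := fun i => (hP.prime.dvd_or_dvd (h1 i)).resolve_right hPg
  obtain ⟨a, ha⟩ := (hP.associated_of_dvd (X_prime (i := (0 : Fin 3))).irreducible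
    (h2 0)).symm.dvd.trans (h2 1)
  have := congrArg (eval ![0, 1, 0]) ha
  simp at this

/-- Absorbs finite sets: one line through each point, chosen with a prescribed property, multiplied
together. -/
lemma exists_form_of_finite {S : Set P2} (hS : S.Finite) {Q : P2 → HPoly → Prop}
    (hQ : ∀ s ∈ S, ∃ c : Fin 3 → ℂ, c ⬝ᵥ s.rep = 0 ∧ Q s (linForm c)) :
    ∃ c : P2 → Fin 3 → ℂ, S ⊆ projZeros (∏ s ∈ hS.toFinset, linForm (c s)) ∧
      (∏ s ∈ hS.toFinset, linForm (c s)).IsHomogeneous hS.toFinset.card ∧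
      ∀ s ∈ S, Q s (linForm (c s)) := by
  choose! c hc hcQ using hQ
  refine ⟨c, fun s hs => ?_, ?_, hcQ⟩
  · rw [projZeros, Set.mem_ofPred_eq, map_prod]
    exact Finset.prod_eq_zero (hS.mem_toFinset.mpr hs) (by rw [eval_linForm, hc s hs])
  · have := IsHomogeneous.prod hS.toFinset (fun s => linForm (c s)) (fun _ => 1)
      fun s _ => linForm_isHomogeneous (c s)
    simpa using this

lemma projZeros_mul (f g : HPoly) : projZeros (f * g) = projZeros f ∪ projZeros g := by
  ext x; simp [projZeros]

lemma dvd_of_projZeros_subset_union {P g : HPoly} {m n : ℕ} (hPh : P.IsHomogeneous m)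
    (hg : g.IsHomogeneous n) (hP : Irreducible P) {S : Set P2} (hS : S.Finite)
    (h : projZeros P ⊆ projZeros g ∪ S) : P ∣ g := by
  obtain ⟨c, hc, hch, hcQ⟩ := exists_form_of_finite hS (Q := fun _ l => ¬ P ∣ l)
    fun s _ => exists_linForm_not_dvd hP s.rep_nonzero
  have h1 := dvd_of_projZeros_subset hPh (hg.mul hch) hP <| by
    rw [projZeros_mul]
    exact h.trans (Set.union_subset_union_right _ hc)
  refine (hP.prime.dvd_or_dvd h1).resolve_right fun h2 => ?_
  obtain ⟨s, hs, hs'⟩ := hP.prime.exists_mem_finset_dvd h2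
  exact hcQ s (hS.mem_toFinset.mp hs) hs'

lemma subset_zariskiClosure (T : Set P2) : T ⊆ zariskiClosure T := fun _ hx _ _ _ h => h hx

/-- The right-hand side is already closed: a point `x` outside it is separated from each `s ∈ S` by
a line through `s` missing `x`. -/
lemma zariskiClosure_subset_union {T S : Set P2} {g : HPoly} {n : ℕ} (hg : g.IsHomogeneous n)
    (hS : S.Finite) (h : T ⊆ projZeros g ∪ S) : zariskiClosure T ⊆ projZeros g ∪ S := by
  intro x hx
  by_contra hxn
  rw [Set.mem_union, not_or] at hxn
  obtain ⟨c, hc, hch, hcQ⟩ := exists_form_of_finite hS (Q := fun _ l => eval x.rep l ≠ 0) <| by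
    intro s hs
    have hne : crossProduct x.rep s.rep ≠ 0 := fun h0 =>
      hxn.2 (eq_of_cross_rep_eq_zero h0 ▸ hs)
    obtain ⟨k, hk⟩ := Function.ne_iff.mp hne
    refine ⟨crossProduct s.rep (Pi.single k 1), ?_, ?_⟩
    · rw [dotProduct_comm, dot_self_cross]
    · rw [eval_linForm, dotProduct_comm, triple_product_permutation, triple_product_permutation]
      simpa using hk
  have h1 := hx (g * ∏ s ∈ hS.toFinset, linForm (c s)) _ (hg.mul hch) <| by
    rw [projZeros_mul]
    exact h.trans (Set.union_subset_union_right _ hc)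
  rw [projZeros_mul] at h1
  rcases h1 with h1 | h1
  · exact hxn.1 h1
  · rw [projZeros, Set.mem_ofPred_eq, map_prod, Finset.prod_eq_zero_iff] at h1
    obtain ⟨s, hs, hs'⟩ := h1
    exact hcQ s (hS.mem_toFinset.mp hs) hs'

lemma exists_irreducible_factors {f : HPoly} (hf : f ≠ 0) :
    ∃ S : Finset HPoly, (∀ P ∈ S, Irreducible P ∧ P ∣ f) ∧
      ∀ x, eval x f = 0 → ∃ P ∈ S, eval x P = 0 := by
  classical
  obtain ⟨s, hs, hsf⟩ := UniqueFactorizationMonoid.exists_prime_factors f hf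
  refine ⟨s.toFinset, fun P hP => ?_, fun x hx => ?_⟩
  · rw [Multiset.mem_toFinset] at hP
    exact ⟨(hs P hP).irreducible, (Multiset.dvd_prod hP).trans hsf.dvd⟩
  · obtain ⟨a, ha⟩ := hsf.symm.dvd
    have h1 : eval x s.prod = 0 := by rw [ha, map_mul, hx, zero_mul]
    rw [map_multiset_prod, Multiset.prod_eq_zero_iff, Multiset.mem_map] at h1
    obtain ⟨P, hP, hPx⟩ := h1
    exact ⟨P, Multiset.mem_toFinset.mpr hP, hPx⟩

/-- Among the irreducible factors of `f₀`, those whose zero set lies in the closed set `D` are kept,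
once each. Any other factor meets `D` in finitely many points. -/
lemma exists_squarefree_equation {D : Set P2}
    (hD : ∀ x, x ∉ D → ∃ (g : HPoly) (n : ℕ), g.IsHomogeneous n ∧ D ⊆ projZeros g ∧
      x ∉ projZeros g) (f₀ : HPoly) :
    ∀ n₀, f₀.IsHomogeneous n₀ → f₀ ≠ 0 → ∃ (f : HPoly) (n : ℕ), f.IsHomogeneous n ∧
      Squarefree f ∧ projZeros f ⊆ D ∧ ((D ∩ projZeros f₀) \ projZeros f).Finite := by
  induction f₀ using WfDvdMonoid.induction_on_irreducible with
  | zero => exact fun _ _ h => absurd rfl h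
  | unit u hu =>
    intro _ _ _
    have h1 : ∀ v : HPoly, IsUnit v → projZeros v = ∅ := fun v hv => by
      ext x
      simpa [projZeros] using (hv.map (eval x.rep)).ne_zero
    refine ⟨1, 0, isHomogeneous_one _ _, squarefree_one, ?_, ?_⟩
    · simp [h1]
    · simp [h1 u hu]
  | mul a P ha hP ih =>
    intro n₀ hn₀ hne
    obtain ⟨m, -, hPh⟩ := hn₀.of_dvd hne (dvd_mul_right P a)
    obtain ⟨k, -, hah⟩ := hn₀.of_dvd hne (dvd_mul_left a P)
    obtain ⟨f, n, hf, hsq, hfD, hfin⟩ := ih k hah ha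
    simp_rw [projZeros_mul, Set.inter_union_distrib_left, Set.union_sdiff_distrib]
    by_cases hPD : projZeros P ⊆ D
    · by_cases hPf : P ∣ f
      · refine ⟨f, n, hf, hsq, hfD, Set.Finite.union ?_ hfin⟩
        obtain ⟨b, rfl⟩ := hPf
        convert! Set.finite_empty
        rw [projZeros_mul, Set.sdiff_eq_empty]
        exact fun x hx => Or.inl hx.2
      · refine ⟨P * f, m + n, hPh.mul hf, ?_, ?_, ?_⟩
        · exact (squarefree_mul_iff).mpr ⟨hP.isRelPrime_iff_not_dvd.mpr hPf, hP.squarefree, hsq⟩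
        · rw [projZeros_mul]; exact Set.union_subset hPD hfD
        · rw [projZeros_mul]
          refine hfin.subset ?_
          rintro x (⟨hx, hx'⟩ | ⟨hx, hx'⟩)
          · exact absurd (Or.inl hx.2) hx'
          · exact ⟨hx, fun h => hx' (Or.inr h)⟩
    · obtain ⟨x, hxP, hxD⟩ := Set.not_subset.mp hPD
      obtain ⟨g, l, hg, hDg, hxg⟩ := hD x hxD
      have hPg : ¬ P ∣ g := fun ⟨b, hb⟩ => hxg (by rw [hb, projZeros_mul]; exact Or.inl hxP)
      refine ⟨f, n, hf, hsq, hfD, Set.Finite.union ?_ hfin⟩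
      exact (finite_projZeros_inter hPh hg hP hPg).subset fun y hy => ⟨hy.1.2, hDg hy.1.1⟩

lemma exists_hasCurveDegree_zariskiClosure {T : Set P2} {f₀ : HPoly} {n₀ : ℕ}
    (hf₀ : f₀.IsHomogeneous n₀) (hne : f₀ ≠ 0) (hT : T ⊆ projZeros f₀) :
    ∃ n, HasCurveDegree (zariskiClosure T) n := by
  obtain ⟨f, n, hf, hsq, hfD, hfin⟩ := exists_squarefree_equation (D := zariskiClosure T) (by
    intro x hx
    simp only [zariskiClosure, Set.mem_ofPred_eq, not_forall] at hx
    obtain ⟨g, n, hg, hTg, hxg⟩ := hx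
    exact ⟨g, n, hg, fun y hy => hy g n hg hTg, hxg⟩) f₀ n₀ hf₀ hne
  refine ⟨n, f, hf, hsq, hfD, hfin.subset ?_⟩
  exact fun x hx => ⟨⟨hx.1, hx.1 f₀ n₀ hf₀ hT⟩, hx.2⟩

end Projective

/-! ### Leading part of the 1-form at a point -/

section Taylor

/-- The translate `f (x + q)`. -/
def shift (q : Fin 3 → ℂ) : HPoly →ₐ[ℂ] HPoly := aeval fun i => X i + C (q i)

lemma eval_shift (q z : Fin 3 → ℂ) (f : HPoly) : eval z (shift q f) = eval (z + q) f := by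
  rw [shift, eval_aeval_eq]
  congr 2 with i
  simp

lemma shift_ne_zero (q : Fin 3 → ℂ) {f : HPoly} (hf : f ≠ 0) : shift q f ≠ 0 := fun h => hf <| by
  refine MvPolynomial.funext fun z => ?_
  have := eval_shift q (z - q) f
  rw [h, sub_add_cancel] at this
  rw [← this, map_zero, map_zero]

lemma tangentCone_eq {f : HPoly} {q : P2} {k : ℕ}
    (hlow : ∀ m < k, homogeneousComponent m (shift q.rep f) = 0)
    (hk : homogeneousComponent k (shift q.rep f) ≠ 0) :
    tangentCone f q = homogeneousComponent k (shift q.rep f) := by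
  have : sInf {m : ℕ | homogeneousComponent m (shift q.rep f) ≠ 0} = k := by
    refine le_antisymm (Nat.sInf_le hk) ?_
    by_contra! hlt
    exact Nat.sInf_mem (s := {m : ℕ | homogeneousComponent m (shift q.rep f) ≠ 0}) ⟨k, hk⟩
      (hlow _ hlt)
  unfold tangentCone initialForm
  rw [← shift, this]

/-- `W` is the vector of homogeneous parts of degree `k` of `ω (q + x)`, and `k` is the order of
vanishing of `ω` at `q`. -/
structure IsLeadingPart (ω : Fin 3 → HPoly) (q : Fin 3 → ℂ) (k : ℕ) (W : Fin 3 → HPoly) : Prop where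
  low : ∀ i, ∀ m < k, homogeneousComponent m (shift q (ω i)) = 0
  eq : ∀ i, homogeneousComponent k (shift q (ω i)) = W i
  ne_zero : ∃ i, W i ≠ 0

lemma exists_isLeadingPart {ω : Fin 3 → HPoly} (hω : ∃ i, ω i ≠ 0) (q : Fin 3 → ℂ) :
    ∃ k W, IsLeadingPart ω q k W := by
  classical
  have h : ∃ k, ∃ i, homogeneousComponent k (shift q (ω i)) ≠ 0 := by
    obtain ⟨i, hi⟩ := hω
    obtain ⟨k, hk⟩ := exists_homogeneousComponent_ne_zero (shift_ne_zero q hi)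
    exact ⟨k, i, hk⟩
  refine ⟨Nat.find h, fun i => homogeneousComponent (Nat.find h) (shift q (ω i)), ?_, fun _ => rfl,
    Nat.find_spec h⟩
  intro i m hm
  by_contra hne
  exact Nat.find_min h hm ⟨i, hne⟩

variable {ω W : Fin 3 → HPoly} {q : Fin 3 → ℂ} {k n : ℕ}

lemma IsLeadingPart.isHomogeneous (h : IsLeadingPart ω q k W) (i : Fin 3) :
    (W i).IsHomogeneous k := by
  rw [← h.eq]; exact homogeneousComponent_isHomogeneous _ _

/-- This is the degree-`k` part of the Euler relation translated to `q`: the terms `x_i ω_i (q + x)`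
start only in degree `k + 1`. -/
lemma IsLeadingPart.sum_eq_zero (h : IsLeadingPart ω q k W) (he : ∑ i, X i * ω i = 0) :
    ∑ i, C (q i) * W i = 0 := by
  refine MvPolynomial.funext fun z => ?_
  have h1 := congrArg (fun f => (restrictRay z (shift q f)).coeff k) he
  have hX : ∀ i, restrictRay z (shift q (X i)) = Polynomial.C (z i) * Polynomial.X +
      Polynomial.C (q i) := fun i => by simp [shift, restrictRay]
  have h2 : ∀ i, (Polynomial.X * restrictRay z (shift q (ω i))).coeff k = 0 := by
    intro i
    rcases k with _ | k
    · simp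
    · rw [Polynomial.coeff_X_mul, coeff_restrictRay, h.low i k (Nat.lt_succ_self k), map_zero]
  simp only [map_sum, map_mul, hX, Polynomial.finsetSum_coeff, add_mul, Polynomial.coeff_add,
    mul_assoc, Polynomial.coeff_C_mul, h2, map_zero, Polynomial.coeff_zero, coeff_restrictRay,
    h.eq, mul_zero, zero_add] at h1
  simpa using h1

/-- By homogeneity, `f (q + s (z + c q)) = (1 + s c)^n f (q + s / (1 + s c) z)`. Dividing by `s^k`
and letting `s → 0` compares the two leading terms. -/
lemma eval_homogeneousComponent_shift_add {f : HPoly} (hf : f.IsHomogeneous n)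
    (hlow : ∀ m < k, homogeneousComponent m (shift q f) = 0) (z : Fin 3 → ℂ) (c : ℂ) :
    eval (z + c • q) (homogeneousComponent k (shift q f)) =
      eval z (homogeneousComponent k (shift q f)) := by
  have hdvd : ∀ y, ∃ E : Polynomial ℂ, restrictRay y (shift q f) = Polynomial.X ^ k * E ∧
      E.eval 0 = eval y (homogeneousComponent k (shift q f)) := by
    intro y
    obtain ⟨E, hE⟩ := Polynomial.X_pow_dvd_iff.mpr fun m hm => by
      rw [coeff_restrictRay y (shift q f) m, hlow m hm, map_zero]
    refine ⟨E, hE, ?_⟩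
    rw [← coeff_restrictRay, hE, Polynomial.coeff_X_pow_mul', if_pos le_rfl, Nat.sub_self,
      Polynomial.coeff_zero_eq_eval_zero]
  obtain ⟨A, hA, hA0⟩ := hdvd (z + c • q)
  obtain ⟨E, hE, hE0⟩ := hdvd z
  rw [← hA0, ← hE0]
  have hφ : ContinuousAt (fun s : ℂ => (1 + s * c) ^ k * A.eval s) 0 := by fun_prop
  have hψ : ContinuousAt (fun s : ℂ => (1 + s * c) ^ n * E.eval (s / (1 + s * c))) 0 := by
    refine ContinuousAt.mul (by fun_prop) (E.continuous.continuousAt.comp ?_)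
    exact ContinuousAt.div (by fun_prop) (by fun_prop) (by simp)
  have hne : ∀ᶠ s : ℂ in nhds 0, 1 + s * c ≠ 0 :=
    ContinuousAt.eventually_ne (by fun_prop) (by simp)
  have heq := (hφ.eventuallyEq_nhds_iff_eventuallyEq_nhdsNE hψ).mp <| by
    filter_upwards [hne.filter_mono nhdsWithin_le_nhds, self_mem_nhdsWithin] with s hs hs0
    have hs0 : s ≠ 0 := hs0
    have h1 := eval_restrictRay (z + c • q) (shift q f) s
    have h2 := eval_restrictRay z (shift q f) (s / (1 + s * c))
    rw [hA, eval_shift] at h1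
    rw [hE, eval_shift] at h2
    have h3 : s • (z + c • q) + q = (1 + s * c) • ((s / (1 + s * c)) • z + q) := by
      ext i
      simp
      field_simp
      ring
    rw [h3, hf.eval_smul, ← h2] at h1
    simp only [Polynomial.eval_mul, Polynomial.eval_pow, Polynomial.eval_X] at h1
    have h4 : s ^ k ≠ 0 := pow_ne_zero _ hs0
    apply mul_left_cancel₀ h4
    rw [mul_left_comm, h1, div_pow]
    field_simp
  simpa using heq.eq_of_nhds

end Taylor

/-! ### Blow-up charts and the criterion for quasi-radial points -/

section BlowUp

/-- The affine line `y ↦ u + y v`, as a triple of polynomials in `y = X 1`. -/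
def lineParam (u v : Fin 3 → ℂ) (i : Fin 3) : MvPolynomial (Fin 2) ℂ := C (u i) + X 1 * C (v i)

lemma eval_aeval_lineParam (u v : Fin 3 → ℂ) (x y : ℂ) (f : HPoly) :
    eval ![x, y] (aeval (lineParam u v) f) = eval (u + y • v) f := by
  rw [eval_aeval_eq]
  congr 2 with i
  simp [lineParam]

/-- The chart is `q + x (u + y v)`, so the pullback is `∑ x^m f_m (u + y v)`, with `f_m` the
components of the translate of `f`. -/
lemma aeval_blowupChart (q u v : Fin 3 → ℂ) (f : HPoly) :
    aeval (blowupChart q u v) f = Polynomial.eval (X 0) ((homogenize _ _ (shift q f)).map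
      (aeval (lineParam u v) : HPoly →ₐ[ℂ] MvPolynomial (Fin 2) ℂ).toRingHom) := by
  have hC : ∀ c : ℂ, Polynomial.eval (X 0) ((homogenize _ _ (C c)).map
      (aeval (lineParam u v) : HPoly →ₐ[ℂ] MvPolynomial (Fin 2) ℂ).toRingHom) = C c := by
    intro c
    rw [← algebraMap_eq, AlgHom.commutes, Polynomial.algebraMap_apply, Polynomial.map_C,
      Polynomial.eval_C]
    exact aeval_C _ c
  induction f using MvPolynomial.induction_on with
  | C a =>
    have h : shift q (C a) = C a := aeval_C _ a
    rw [h, hC, aeval_C, algebraMap_eq]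
  | add p r hp hr => simp only [map_add, Polynomial.map_add, Polynomial.eval_add, hp, hr]
  | mul_X p i hp =>
    have h : shift q (X i) = X i + C (q i) := aeval_X _ i
    have h' : homogenize (Fin 3) ℂ (X i) = Polynomial.C (X i) * Polynomial.X := aeval_X _ i
    have h'' : (aeval (lineParam u v) : HPoly →ₐ[ℂ] MvPolynomial (Fin 2) ℂ).toRingHom (X i) =
        lineParam u v i := aeval_X _ i
    simp only [map_mul, Polynomial.map_mul, Polynomial.eval_mul, hp, aeval_X, h, map_add, h',
      Polynomial.map_add, Polynomial.eval_add, hC, Polynomial.map_C, Polynomial.map_X,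
      Polynomial.eval_C, Polynomial.eval_X, h'']
    congr 1
    simp only [blowupChart, lineParam]
    ring

lemma exists_aeval_blowupChart_eq {f : HPoly} {q : Fin 3 → ℂ} {k : ℕ}
    (hlow : ∀ m < k, homogeneousComponent m (shift q f) = 0) (u v : Fin 3 → ℂ) :
    ∃ E, aeval (blowupChart q u v) f = X 0 ^ k *
      (aeval (lineParam u v) (homogeneousComponent k (shift q f)) + X 0 * E) := by
  have hcomp := aeval_blowupChart q u v f
  obtain ⟨E, hE⟩ := Polynomial.X_pow_dvd_iff.mpr fun m hm => by
    rw [coeff_homogenize (shift q f) m, hlow m hm]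
  have hE0 : E.coeff 0 = homogeneousComponent k (shift q f) := by
    rw [← coeff_homogenize, hE, Polynomial.coeff_X_pow_mul', if_pos le_rfl, Nat.sub_self]
  rw [hcomp, hE, ← Polynomial.divX_mul_X_add E, hE0]
  refine ⟨Polynomial.eval (X 0) (E.divX.map (aeval (lineParam u v) :
    HPoly →ₐ[ℂ] MvPolynomial (Fin 2) ℂ).toRingHom), ?_⟩
  simp only [Polynomial.map_mul, Polynomial.map_add, Polynomial.map_pow, Polynomial.map_X,
    Polynomial.map_C, Polynomial.eval_mul, Polynomial.eval_add, Polynomial.eval_pow,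
    Polynomial.eval_X, Polynomial.eval_C]
  rw [add_comm, mul_comm (X 0 : MvPolynomial (Fin 2) ℂ)]
  rfl

lemma not_X_dvd_aeval_lineParam_add {f : HPoly} {u v : Fin 3 → ℂ} {y : ℂ}
    (h : eval (u + y • v) f ≠ 0) (E : MvPolynomial (Fin 2) ℂ) :
    ¬ X 0 ∣ aeval (lineParam u v) f + X 0 * E := fun ⟨a, ha⟩ => h <| by
  have := congrArg (eval ![0, y]) ha
  rw [map_add, eval_aeval_lineParam] at this
  simpa using this

lemma pderiv_zero_blowupChart (q u v : Fin 3 → ℂ) (i : Fin 3) :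
    pderiv 0 (blowupChart q u v i) = lineParam u v i := by
  simp [blowupChart, lineParam, pderiv_X, mul_comm (C (v i))]

lemma pderiv_one_blowupChart (q u v : Fin 3 → ℂ) (i : Fin 3) :
    pderiv 1 (blowupChart q u v i) = X 0 * C (v i) := by
  simp [blowupChart, pderiv_X, mul_comm (C (v i))]

lemma linearIndependent_iff_dot_cross (q u v : Fin 3 → ℂ) :
    LinearIndependent ℂ ![q, u, v] ↔ q ⬝ᵥ crossProduct u v ≠ 0 := by
  rw [triple_product_eq_det, ← isUnit_iff_ne_zero]
  exact Matrix.linearIndependent_rows_iff_isUnit.trans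
    (Matrix.isUnit_iff_isUnit_det (Matrix.of ![q, u, v]))

/-- Cramer's rule in the frame `q, u, v`. -/
lemma dot_cross_smul_eq (q u v z : Fin 3 → ℂ) :
    (q ⬝ᵥ crossProduct u v) • z = (z ⬝ᵥ crossProduct u v) • q + (z ⬝ᵥ crossProduct v q) • u +
      (z ⬝ᵥ crossProduct q u) • v := by
  ext i
  fin_cases i <;> simp [dotProduct, Fin.sum_univ_three, cross_apply] <;> ring

variable {ω W : Fin 3 → HPoly} {q : Fin 3 → ℂ} {k n : ℕ}

lemma IsLeadingPart.exists_pullbackForm (h : IsLeadingPart ω q k W) (u v : Fin 3 → ℂ) :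
    ∃ E : Fin 2 → MvPolynomial (Fin 2) ℂ,
      pullbackForm (blowupChart q u v) ω 0 =
        X 0 ^ k * (aeval (lineParam u v) (∑ i, X i * W i) + X 0 * E 0) ∧
      pullbackForm (blowupChart q u v) ω 1 =
        X 0 ^ (k + 1) * (aeval (lineParam u v) (∑ i, C (v i) * W i) + X 0 * E 1) := by
  choose E hE using fun i => exists_aeval_blowupChart_eq (h.low i) u v
  refine ⟨![∑ i, E i * lineParam u v i, ∑ i, E i * C (v i)], ?_, ?_⟩
  · simp only [pullbackForm, pderiv_zero_blowupChart, hE, h.eq, map_add, map_mul, aeval_X,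
      Matrix.cons_val_zero, Fin.sum_univ_three]
    ring
  · simp only [pullbackForm, pderiv_one_blowupChart, hE, h.eq, map_add, map_mul, aeval_C,
      Matrix.cons_val_one, Matrix.cons_val_zero, Fin.sum_univ_three,
      algebraMap_eq]
    ring

lemma IsLeadingPart.exists_isStrictTransform (h : IsLeadingPart ω q k W)
    (he : ∑ i, X i * ω i = 0) (hh : ∀ i, (ω i).IsHomogeneous n) (hR : ∑ i, X i * W i ≠ 0)
    {u v : Fin 3 → ℂ} (hind : LinearIndependent ℂ ![q, u, v]) :
    ∃ η, IsStrictTransform ω q u v η ∧ X 0 ∣ η 1 := by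
  obtain ⟨E, hE0, hE1⟩ := h.exists_pullbackForm u v
  have hdet := (linearIndependent_iff_dot_cross q u v).mp hind
  have hRh : (∑ i, X i * W i).IsHomogeneous (1 + k) :=
    IsHomogeneous.sum _ _ _ fun i _ => (isHomogeneous_X _ i).mul (h.isHomogeneous i)
  have hRinv : ∀ (z : Fin 3 → ℂ) (c : ℂ), eval (z + c • q) (∑ i, X i * W i) = eval z (∑ i, X i * W i) := by
    intro z c
    have h1 := congrArg (eval z) (h.sum_eq_zero he)
    simp only [map_sum, map_mul, eval_X, eval_C, map_zero] at h1 ⊢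
    have h2 : ∀ i, eval (z + c • q) (W i) = eval z (W i) := fun i => by
      rw [← h.eq]; exact eval_homogeneousComponent_shift_add (hh i) (h.low i) z c
    simp only [h2, Pi.add_apply, Pi.smul_apply, smul_eq_mul, add_mul, Finset.sum_add_distrib,
      mul_assoc, ← Finset.mul_sum, h1, mul_zero, add_zero]
  have hvq : crossProduct v q ≠ 0 := fun h0 => hdet <| by
    rw [triple_product_permutation, h0, dotProduct_zero]
  obtain ⟨z, hz⟩ : ∃ z, eval z ((∑ i, X i * W i) * linForm (crossProduct v q)) ≠ 0 := by
    by_contra! h0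
    exact mul_ne_zero hR (linForm_ne_zero hvq) (MvPolynomial.funext fun z => by simpa using h0 z)
  rw [map_mul, eval_linForm, dotProduct_comm] at hz
  -- Modulo `q`, along which `R` is invariant, `z` is proportional to `u + y v` with `y` the ratio
  -- of its coordinates. Thus `R` is not identically zero on the exceptional divisor, and exactly
  -- `x^k` can be divided out.
  have hy : eval (u + ((z ⬝ᵥ crossProduct v q)⁻¹ * (z ⬝ᵥ crossProduct q u)) • v)
      (∑ i, X i * W i) ≠ 0 := by
    intro h0
    apply left_ne_zero_of_mul hz
    have h1 := hRh.eval_smul (q ⬝ᵥ crossProduct u v) z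
    rw [dot_cross_smul_eq, add_assoc, add_comm, hRinv] at h1
    have h2 : (z ⬝ᵥ crossProduct v q) • u + (z ⬝ᵥ crossProduct q u) • v = (z ⬝ᵥ crossProduct v q) •
        (u + ((z ⬝ᵥ crossProduct v q)⁻¹ * (z ⬝ᵥ crossProduct q u)) • v) := by
      rw [smul_add, smul_smul, mul_inv_cancel_left₀ (right_ne_zero_of_mul hz)]
    rw [h2, hRh.eval_smul, h0, mul_zero] at h1
    exact (mul_eq_zero.mp h1.symm).resolve_left (pow_ne_zero _ hdet)
  refine ⟨![aeval (lineParam u v) (∑ i, X i * W i) + X 0 * E 0,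
    X 0 * (aeval (lineParam u v) (∑ i, C (v i) * W i) + X 0 * E 1)], ⟨⟨k, ?_⟩, 0, ?_⟩, ?_⟩
  · rw [Fin.forall_fin_two]
    refine ⟨hE0, hE1.trans ?_⟩
    simp only [Matrix.cons_val_one, Matrix.cons_val_zero]
    ring
  · exact not_X_dvd_aeval_lineParam_add hy _
  · exact dvd_mul_right _ _

lemma IsLeadingPart.exists_not_isStrictTransform (h : IsLeadingPart ω q k W)
    (he : ∑ i, X i * ω i = 0) (hq : q ≠ 0) (hR : ∑ i, X i * W i = 0) :
    ∃ u v : Fin 3 → ℂ, LinearIndependent ℂ ![q, u, v] ∧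
      ∀ η, IsStrictTransform ω q u v η → ¬ X 0 ∣ η 1 := by
  obtain ⟨H, hH⟩ := exists_eq_crossProduct_mul hq (h.sum_eq_zero he) hR
  have hev : ∀ z i, eval z (W i) = crossProduct z q i * eval z H := by
    intro z i
    rw [hH, map_mul]
    congr 1
    fin_cases i <;> simp [cross_apply]
  obtain ⟨j, hj⟩ := h.ne_zero
  obtain ⟨u, hu⟩ : ∃ u, eval u (W j) ≠ 0 := by
    by_contra! h0
    exact hj (MvPolynomial.funext fun z => by simpa using h0 z)
  have hWj := hev u j
  rw [hWj] at hu
  -- The determinant is, up to sign, the factor `(u × q) j` of `W j` evaluated at `u`.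
  have hind : LinearIndependent ℂ ![q, u, Pi.single j 1] := by
    rw [linearIndependent_iff_dot_cross, triple_product_permutation, triple_product_permutation,
      ← cross_anticomm, dotProduct_neg, neg_ne_zero, single_one_dotProduct]
    exact left_ne_zero_of_mul hu
  refine ⟨u, Pi.single j 1, hind, fun η ⟨⟨l, hl⟩, i, hi⟩ hdvd => ?_⟩
  obtain ⟨E, hE0, hE1⟩ := h.exists_pullbackForm u (Pi.single j 1)
  rw [hR, map_zero, zero_add, ← mul_assoc, ← pow_succ] at hE0
  have hall : ∀ i, (X 0 : MvPolynomial (Fin 2) ℂ) ^ (k + 1) ∣ X 0 ^ l * η i := by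
    rw [Fin.forall_fin_two, ← hl 0, ← hl 1, hE0, hE1]
    exact ⟨dvd_mul_right _ _, dvd_mul_right _ _⟩
  have hX0 : (X 0 : MvPolynomial (Fin 2) ℂ) ≠ 0 := X_ne_zero 0
  -- Both coefficients of the pullback are divisible by `x^(k+1)`. Dividing by less contradicts
  -- maximality; dividing by at least that much is incompatible with `x ∣ η 1`, since `W j` is
  -- nonzero at `u`.
  rcases Nat.lt_or_ge k l with hkl | hkl
  · obtain ⟨m, rfl⟩ := Nat.exists_eq_add_of_le (Nat.succ_le_of_lt hkl)
    rw [hl 1, pow_add, mul_assoc] at hE1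
    have h1 := mul_left_cancel₀ (pow_ne_zero _ hX0) hE1
    refine not_X_dvd_aeval_lineParam_add (y := 0) ?_ (E 1) (h1 ▸ hdvd.mul_left _)
    simpa [hWj, Pi.single_apply] using hu
  · obtain ⟨m, rfl⟩ := Nat.exists_eq_add_of_le hkl
    have h1 := hall i
    rw [add_assoc, pow_add, mul_dvd_mul_iff_left (pow_ne_zero _ hX0), pow_succ] at h1
    exact hi ((dvd_mul_left _ _).trans h1)

end BlowUp

/-! ### Generic conditions -/

section Generic

lemma ForGeneric.of_ne_zero {P : P2 → Prop} {G : HPoly} {n : ℕ} (hG : G.IsHomogeneous n)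
    (h0 : G ≠ 0) (h : ∀ p : P2, eval p.rep G ≠ 0 → P p) : ForGeneric P :=
  ⟨G, n, hG, h0, h⟩

lemma ForGeneric.mono {P Q : P2 → Prop} (h : ForGeneric P) (hPQ : ∀ p, P p → Q p) :
    ForGeneric Q := by
  obtain ⟨G, n, hG, h0, hp⟩ := h
  exact ⟨G, n, hG, h0, fun p hpG => hPQ p (hp p hpG)⟩

lemma ForGeneric.and {P Q : P2 → Prop} (hP : ForGeneric P) (hQ : ForGeneric Q) :
    ForGeneric fun p => P p ∧ Q p := by
  obtain ⟨G, n, hG, hG0, hPG⟩ := hP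
  obtain ⟨H, m, hH, hH0, hQH⟩ := hQ
  refine ⟨G * H, n + m, hG.mul hH, mul_ne_zero hG0 hH0, fun p hp => ?_⟩
  rw [projZeros_mul, Set.mem_union, not_or] at hp
  exact ⟨hPG p hp.1, hQH p hp.2⟩

lemma ForGeneric.forall_mem_finite {ι : Type*} {S : Set ι} (hS : S.Finite) {P : ι → P2 → Prop}
    (h : ∀ s ∈ S, ForGeneric (P s)) : ForGeneric fun p => ∀ s ∈ S, P s p := by
  induction S, hS using Set.Finite.induction_on with
  | empty => exact ⟨1, 0, isHomogeneous_one _ _, one_ne_zero, fun _ _ _ hs => hs.elim⟩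
  | insert ha hs ih =>
    refine ((h _ (Set.mem_insert _ _)).and (ih fun s hs => h s (Set.mem_insert_of_mem _ hs))).mono
      fun p hp s hs => ?_
    rcases hs with rfl | hs
    exacts [hp.1, hp.2 s hs]

end Generic

/-- Expansion of a covector in the basis dual to `q, u, v`: it is determined by its values on the
frame. -/
lemma smul_eq_dot_smul_cross (q u v N : Fin 3 → ℂ) :
    (q ⬝ᵥ crossProduct u v) • N = (q ⬝ᵥ N) • crossProduct u v + (u ⬝ᵥ N) • crossProduct v q +
      (v ⬝ᵥ N) • crossProduct q u := by
  ext i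
  fin_cases i <;> simp [dotProduct, Fin.sum_univ_three, cross_apply] <;> ring

/-! ### Singular points, tangent cones of polars, and non-invariant tangent lines -/

namespace PlaneFoliation

variable {d : ℕ} (F : PlaneFoliation d)

/-- The coefficient vector of the 1-form at a point of the affine cone. -/
def val (x : Fin 3 → ℂ) : Fin 3 → ℂ := fun i => eval x (F.form i)

/-- The polar with respect to a vector. -/
def polarForm (a : Fin 3 → ℂ) : HPoly := ∑ i, C (a i) * F.form i

lemma polar_eq (p : P2) : F.polar p = F.polarForm p.rep := rfl

lemma eval_polarForm (a x : Fin 3 → ℂ) : eval x (F.polarForm a) = a ⬝ᵥ F.val x := by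
  simp [polarForm, dotProduct, val]

lemma polarForm_isHomogeneous (a : Fin 3 → ℂ) : (F.polarForm a).IsHomogeneous (d + 1) :=
  IsHomogeneous.sum _ _ _ fun i _ => (F.isHomogeneous i).C_mul _

lemma dot_val (x : Fin 3 → ℂ) : x ⬝ᵥ F.val x = 0 := by
  have := congrArg (eval x) F.euler
  simpa [dotProduct, val] using this

lemma val_zero : F.val 0 = 0 := by
  ext i
  have := (F.isHomogeneous i).eval_smul 0 0
  simpa [val] using this

lemma exists_form_ne_zero : ∃ i, F.form i ≠ 0 := by
  by_contra! h
  exact not_isUnit_zero (F.codim_two 0 fun i => by rw [h i])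

/-- Otherwise the 1-form is `(x × a) H` with `H` a common factor, hence a constant. The coefficients
would then have degree `1`, excluded by `1 ≤ d`. -/
lemma polarForm_ne_zero (hd : 1 ≤ d) {a : Fin 3 → ℂ} (ha : a ≠ 0) : F.polarForm a ≠ 0 := by
  intro h
  obtain ⟨H, hH⟩ := exists_eq_crossProduct_mul ha h F.euler
  obtain ⟨i, hi⟩ := F.exists_form_ne_zero
  have hu : IsUnit H := F.codim_two H fun i => ⟨_, (hH i).trans (mul_comm _ _)⟩
  have hH0 : H.IsHomogeneous 0 := by
    obtain ⟨c, -, rfl⟩ := isUnit_iff_eq_C_of_isReduced.mp hu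
    exact isHomogeneous_C _ _
  have h1 : (F.form i).IsHomogeneous (1 + 0) := by
    rw [hH]
    refine IsHomogeneous.mul ?_ hH0
    have hsub : ∀ j k : Fin 3, (X j * C (a k) - X k * C (a j) : HPoly).IsHomogeneous 1 := by
      intro j k
      rw [mul_comm, mul_comm (X k)]
      exact (isHomogeneous_C_mul_X _ _).sub (isHomogeneous_C_mul_X _ _)
    fin_cases i <;> exact hsub _ _
  have := (F.isHomogeneous i).inj_right h1 hi
  omega

lemma mem_sing_mk {v : Fin 3 → ℂ} (hv : v ≠ 0) :
    (Projectivization.mk ℂ v hv : P2) ∈ F.sing ↔ F.val v = 0 := by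
  rw [funext_iff]
  exact forall_congr' fun i => mk_mem_projZeros (F.isHomogeneous i) hv

/-- Each irreducible component of one nonzero coefficient fails to divide some other coefficient,
and so meets its zero set in finitely many points. -/
lemma sing_finite : F.sing.Finite := by
  obtain ⟨i, hi⟩ := F.exists_form_ne_zero
  obtain ⟨S, hS, hSx⟩ := exists_irreducible_factors hi
  have hcov : F.sing ⊆ ⋃ P ∈ S, {x | x ∈ F.sing ∧ eval x.rep P = 0} := by
    intro x hx
    obtain ⟨P, hP, hPx⟩ := hSx _ (hx i)
    exact Set.mem_biUnion (Finset.mem_coe.mpr hP) ⟨hx, hPx⟩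
  refine (S.finite_toSet.biUnion fun P hP => ?_).subset hcov
  obtain ⟨hirr, hdvd⟩ := hS P hP
  obtain ⟨m, -, hm⟩ := (F.isHomogeneous i).of_dvd hi hdvd
  obtain ⟨j, hj⟩ : ∃ j, ¬ P ∣ F.form j := by
    by_contra! h
    exact hirr.not_isUnit (F.codim_two P h)
  exact (finite_projZeros_inter hm (F.isHomogeneous j) hirr hj).subset fun x hx => ⟨hx.2, hx.1 j⟩

lemma isQuasiRadial_iff {q : P2} (hq : q ∈ F.sing) {k : ℕ} {W : Fin 3 → HPoly}
    (h : IsLeadingPart F.form q.rep k W) : F.IsQuasiRadial q ↔ ∑ i, X i * W i = 0 := by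
  refine ⟨fun hQR => ?_, fun hR => ⟨hq, fun hinv => ?_⟩⟩
  · by_contra hR
    exact hQR.2 fun u v hind => h.exists_isStrictTransform F.euler F.isHomogeneous hR hind
  · obtain ⟨u, v, hind, hη⟩ := h.exists_not_isStrictTransform F.euler q.rep_nonzero hR
    obtain ⟨η, hη1, hη2⟩ := hinv u v hind
    exact hη η hη1 hη2

end PlaneFoliation

/-- The lowest part of the Taylor expansion of `f` at `q` contains the linear form `c` exactly once
over the direction `u`. -/
def HasTransverseFactor (f : HPoly) (q u c : Fin 3 → ℂ) : Prop :=
  ∃ (k : ℕ) (H : HPoly), (∀ m < k, homogeneousComponent m (shift q f) = 0) ∧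
    homogeneousComponent k (shift q f) = linForm c * H ∧ eval u H ≠ 0

namespace PlaneFoliation

variable {d : ℕ} (F : PlaneFoliation d)

lemma forGeneric_tangentConeMult {q : P2} (hq : q ∈ F.sing) : ForGeneric fun p => p ≠ q →
    (¬ F.IsQuasiRadial q → tangentConeMult (F.polar p) p q = 0) ∧
    (F.IsQuasiRadial q → tangentConeMult (F.polar p) p q = 1 ∧
      HasTransverseFactor (F.polar p) q.rep p.rep (crossProduct q.rep p.rep)) := by
  obtain ⟨k, W, h⟩ := exists_isLeadingPart F.exists_form_ne_zero q.rep
  have hcomp : ∀ (p : P2) m, homogeneousComponent m (shift q.rep (F.polar p)) =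
      ∑ i, C (p.rep i) * homogeneousComponent m (shift q.rep (F.form i)) := by
    intro p m
    simp only [polar, map_sum, map_mul, ← homogeneousComponent_C_mul]
    simp [shift]
  have hlow : ∀ (p : P2), ∀ m < k, homogeneousComponent m (shift q.rep (F.polar p)) = 0 := by
    intro p m hm
    rw [hcomp]
    exact Finset.sum_eq_zero fun i _ => by rw [h.low i m hm, mul_zero]
  have hk : ∀ p : P2, homogeneousComponent k (shift q.rep (F.polar p)) =
      ∑ i, C (p.rep i) * W i := by
    intro p
    simp only [hcomp, h.eq]
  by_cases hR : ∑ i, X i * W i = 0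
  · have hQR := (F.isQuasiRadial_iff hq h).mpr hR
    obtain ⟨H, hH⟩ := exists_eq_crossProduct_mul q.rep_nonzero (h.sum_eq_zero F.euler) hR
    obtain ⟨j, hj⟩ := h.ne_zero
    refine ForGeneric.of_ne_zero (h.isHomogeneous j) hj fun p hp hpq =>
      ⟨fun hn => absurd hQR hn, fun _ => ?_⟩
    -- The genericity condition `W j ≠ 0` at `p` already forces the cofactor `H` to be nonzero
    -- there.
    have hHp : eval p.rep H ≠ 0 := by
      rw [hH, map_mul] at hp
      exact right_ne_zero_of_mul hp
    have hk' : homogeneousComponent k (shift q.rep (F.polar p)) =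
        linForm (crossProduct q.rep p.rep) * H := by
      rw [hk, linForm]
      simp only [hH, Fin.sum_univ_three, cross_apply, Matrix.cons_val, map_sub, map_mul]
      ring
    refine ⟨?_, k, H, hlow p, hk', hHp⟩
    have hc : crossProduct p.rep q.rep ≠ 0 := fun h0 => hpq (eq_of_cross_rep_eq_zero h0)
    have hl : linForm (crossProduct q.rep p.rep) = - lineForm p q := by
      rw [← cross_anticomm]
      simp [linForm, lineForm]
    have hl0 : lineForm p q ≠ 0 := linForm_ne_zero hc
    have hH0 : H ≠ 0 := fun h0 => hHp (by rw [h0, map_zero])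
    rw [tangentConeMult, tangentCone_eq (hlow p), hk', hl, neg_mul, ← mul_neg]
    · refine emultiplicity_eq_coe.mpr ⟨by rw [pow_one]; exact dvd_mul_right _ _, fun hdvd => hHp ?_⟩
      rw [pow_succ, pow_one, mul_dvd_mul_iff_left hl0, dvd_neg] at hdvd
      obtain ⟨a, ha⟩ := hdvd
      have h1 : eval p.rep (lineForm p q) = 0 := by
        refine (eval_linForm _ _).trans ?_
        rw [dotProduct_comm, dot_self_cross]
      rw [ha, map_mul, h1, zero_mul]
    · rw [hk', hl]
      exact mul_ne_zero (neg_ne_zero.mpr hl0) hH0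
  · have hQR : ¬ F.IsQuasiRadial q := fun h' => hR ((F.isQuasiRadial_iff hq h).mp h')
    have hRh : (∑ i, X i * W i).IsHomogeneous (1 + k) :=
      IsHomogeneous.sum _ _ _ fun i _ => (isHomogeneous_X _ i).mul (h.isHomogeneous i)
    refine ForGeneric.of_ne_zero hRh hR fun p hp hpq => ⟨fun _ => ?_, fun h' => absurd h' hQR⟩
    have hev : eval p.rep (∑ i, C (p.rep i) * W i) ≠ 0 := by simpa using hp
    rw [tangentConeMult, tangentCone_eq (hlow p), hk, emultiplicity_eq_zero]
    · rintro ⟨a, ha⟩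
      have h1 : eval p.rep (lineForm p q) = 0 := by
        refine (eval_linForm _ _).trans ?_
        rw [dotProduct_comm, dot_self_cross]
      exact hev (by rw [ha, map_mul, h1, zero_mul])
    · rw [hk]
      exact fun h0 => hev (by rw [h0, map_zero])

lemma forGeneric_polarForm_ne_zero (hd : 1 ≤ d) (q : P2) :
    ForGeneric fun p => q.rep ⬝ᵥ F.val p.rep ≠ 0 :=
  ForGeneric.of_ne_zero (F.polarForm_isHomogeneous q.rep) (F.polarForm_ne_zero hd q.rep_nonzero)
    fun p hp => by rwa [eval_polarForm] at hp

lemma forGeneric_not_collinear {q q' : P2} (h : q ≠ q') :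
    ForGeneric fun p => crossProduct q.rep q'.rep ⬝ᵥ p.rep ≠ 0 :=
  ForGeneric.of_ne_zero (linForm_isHomogeneous (crossProduct q.rep q'.rep))
    (linForm_ne_zero fun h0 => h (eq_of_cross_rep_eq_zero h0))
    fun p hp => by rwa [eval_linForm] at hp

/-- The tangent line at a generic point is not invariant. -/
lemma forGeneric_exists_tangent_polar_ne_zero (hd : 1 ≤ d) :
    ForGeneric fun p => ∃ y, F.val p.rep ⬝ᵥ y = 0 ∧ eval y (F.polar p) ≠ 0 := by
  -- The points `F.val p × w` run over the tangent line at `p`; `G w` tests whether the polar of `p`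
  -- vanishes at such a point.
  set G : (Fin 3 → ℂ) → HPoly := fun w =>
    ∑ i, X i * aeval (crossProduct F.form fun j => C (w j)) (F.form i) with hG
  have hGev : ∀ w p, eval p (G w) = p ⬝ᵥ F.val (crossProduct (F.val p) w) := by
    intro w p
    simp only [hG, map_sum, map_mul, eval_X, eval_aeval_eq, dotProduct, val]
    refine Finset.sum_congr rfl fun i _ => ?_
    congr 3 with j
    fin_cases j <;> simp [cross_apply, val]
  have hGh : ∀ w, (G w).IsHomogeneous (1 + (d + 1) * (d + 1)) := by
    intro w
    refine IsHomogeneous.sum _ _ _ fun i _ => (isHomogeneous_X _ i).mul ?_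
    refine (F.isHomogeneous i).aeval _ fun j => ?_
    have hsub : ∀ j k : Fin 3, (F.form j * C (w k) - F.form k * C (w j)).IsHomogeneous (d + 1) := by
      intro j k
      rw [mul_comm, mul_comm (F.form k)]
      exact ((F.isHomogeneous j).C_mul _).sub ((F.isHomogeneous k).C_mul _)
    fin_cases j <;> exact hsub _ _
  by_cases hw : ∃ w, G w ≠ 0
  · obtain ⟨w, hw⟩ := hw
    refine ForGeneric.of_ne_zero (hGh w) hw fun p hp => ⟨crossProduct (F.val p.rep) w, ?_, ?_⟩
    · exact dot_self_cross _ _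
    · rwa [polar_eq, eval_polarForm, ← hGev]
  · exfalso
    push Not at hw
    have hzero : ∀ w p, p ⬝ᵥ F.val (crossProduct (F.val p) w) = 0 := fun w p => by
      rw [← hGev, hw, map_zero]
    obtain ⟨i, hi⟩ := F.exists_form_ne_zero
    obtain ⟨a, ha⟩ : ∃ a, eval a (F.form i) ≠ 0 := by
      by_contra! h0
      exact hi (MvPolynomial.funext fun z => by simpa using h0 z)
    have hva : F.val a ≠ 0 := fun h0 => ha (congrFun h0 i)
    have ha0 : a ≠ 0 := fun h0 => hva (by rw [h0, val_zero])
    set S := F.sing_finite.toFinset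
    -- If every `G w` is zero, every tangent line is invariant. The point `b` is chosen so that `a`
    -- and `b` lie off each other's tangent lines and the tangent line at `b` avoids all
    -- singularities.
    have hprod : F.polarForm a * linForm (F.val a) * ∏ q ∈ S, F.polarForm q.rep ≠ 0 :=
      mul_ne_zero (mul_ne_zero (F.polarForm_ne_zero hd ha0) (linForm_ne_zero hva))
        (Finset.prod_ne_zero_iff.mpr fun q _ => F.polarForm_ne_zero hd q.rep_nonzero)
    obtain ⟨b, hb⟩ : ∃ b, eval b (F.polarForm a * linForm (F.val a) *
        ∏ q ∈ S, F.polarForm q.rep) ≠ 0 := by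
      by_contra! h0
      exact hprod (MvPolynomial.funext fun z => by simpa using h0 z)
    rw [map_mul, map_mul, map_prod, eval_polarForm, eval_linForm] at hb
    have hb1 := left_ne_zero_of_mul hb
    have hb2 := Finset.prod_ne_zero_iff.mp (right_ne_zero_of_mul hb)
    -- The two invariant tangent lines meet at `y`. There the 1-form kills the independent vectors
    -- `a`, `b`, `y`, so `y` is a singularity on the tangent line at `b`, a contradiction.
    set y := crossProduct (F.val a) (F.val b) with hy
    have h1 : a ⬝ᵥ F.val y = 0 := hzero _ _
    have h2 : b ⬝ᵥ F.val y = 0 := by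
      have := hzero (-F.val a) b
      rwa [map_neg, cross_anticomm] at this
    have h3 : a ⬝ᵥ crossProduct b y ≠ 0 := by
      rw [triple_product_permutation, triple_product_permutation, dotProduct_comm,
        cross_dot_cross, dot_val, zero_mul, zero_sub, neg_ne_zero, dotProduct_comm b]
      exact hb1
    have hy0 : y ≠ 0 := fun h0 => h3 (by rw [h0, map_zero, dotProduct_zero])
    have h4 : F.val y = 0 := by
      have := smul_eq_dot_smul_cross a b y (F.val y)
      rw [h1, h2, dot_val, zero_smul, zero_smul, zero_smul, add_zero, add_zero] at this
      exact (smul_eq_zero.mp this).resolve_left h3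
    obtain ⟨t, ht⟩ := Projectivization.exists_smul_eq_mk_rep ℂ y hy0
    refine hb2 (Projectivization.mk ℂ y hy0)
      (F.sing_finite.mem_toFinset.mpr ((F.mem_sing_mk hy0).mpr h4)) ?_
    rw [eval_polarForm, ← ht, Units.smul_def, smul_dotProduct, dotProduct_comm, dot_cross_self,
      smul_zero]

end PlaneFoliation

/-! ### Gradients and restriction to lines -/

section Gradient

/-- The gradient of `f` at `x`. -/
def grad (f : HPoly) (x : Fin 3 → ℂ) : Fin 3 → ℂ := fun i => eval x (pderiv i f)

lemma dot_grad {f : HPoly} {n : ℕ} (hf : f.IsHomogeneous n) (x : Fin 3 → ℂ) :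
    x ⬝ᵥ grad f x = n * eval x f := by
  have := congrArg (eval x) hf.sum_X_mul_pderiv
  simpa [dotProduct, grad] using this

lemma grad_smul {f : HPoly} {n : ℕ} (hf : f.IsHomogeneous n) (t : ℂ) (x : Fin 3 → ℂ) :
    grad f (t • x) = t ^ (n - 1) • grad f x := by
  ext i
  exact hf.pderiv.eval_smul t x

lemma grad_mul_of_eval_eq_zero {f g : HPoly} {x : Fin 3 → ℂ} (hf : eval x f = 0) :
    grad (f * g) x = eval x g • grad f x := by
  ext i
  simp [grad, Derivation.leibniz, hf]

lemma derivation_aeval {A : Type*} [CommRing A] [Algebra ℂ A] (D : Derivation ℂ A A)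
    (a : Fin 3 → A) (f : HPoly) : D (aeval a f) = ∑ i, aeval a (pderiv i f) * D (a i) := by
  induction f using MvPolynomial.induction_on with
  | C c => simp
  | add p q hp hq => simp only [map_add, hp, hq, add_mul, Finset.sum_add_distrib]
  | mul_X p j hp =>
    simp only [map_mul, aeval_X, Derivation.leibniz, hp, smul_eq_mul, map_add, add_mul,
      Finset.sum_add_distrib, pderiv_X, Finset.mul_sum]
    congr 1
    · rw [Finset.sum_eq_single j]
      · simp
      · intro i _ hij
        simp [hij.symm]
      · simp
    · exact Finset.sum_congr rfl fun i _ => by ring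

/-- The restriction of `f` to the affine line `t ↦ x + t y`. -/
def restrictLine (x y : Fin 3 → ℂ) : HPoly →ₐ[ℂ] Polynomial ℂ :=
  aeval fun i => Polynomial.C (x i) + Polynomial.C (y i) * Polynomial.X

lemma eval_restrictLine (x y : Fin 3 → ℂ) (f : HPoly) (t : ℂ) :
    (restrictLine x y f).eval t = eval (x + t • y) f := by
  rw [restrictLine, polynomial_eval_aeval]
  congr 2 with i
  simp [mul_comm t]

lemma eval_eq_zero_of_forall_ne_zero {f : HPoly} {x y : Fin 3 → ℂ}
    (h : ∀ t : ℂ, t ≠ 0 → eval (x + t • y) f = 0) : eval x f = 0 := by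
  have h0 : restrictLine x y f = 0 := by
    apply Polynomial.eq_zero_of_infinite_isRoot
    refine (Set.finite_singleton (0 : ℂ)).infinite_compl.mono fun t ht => ?_
    simpa [eval_restrictLine] using h t ht
  have := eval_restrictLine x y f 0
  rw [h0] at this
  simpa using this.symm

lemma eval_add_smul_of_derivative_eq_zero {f : HPoly} {y : Fin 3 → ℂ}
    (h : ∑ i, C (y i) * pderiv i f = 0) (x : Fin 3 → ℂ) (t : ℂ) :
    eval (x + t • y) f = eval x f := by
  have h1 : Polynomial.derivative (restrictLine x y f) = 0 := by
    have := derivation_aeval Polynomial.derivative'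
      (fun i => Polynomial.C (x i) + Polynomial.C (y i) * Polynomial.X) f
    refine this.trans ?_
    have h2 := congrArg (restrictLine x y) h
    rw [map_sum, map_zero] at h2
    rw [← h2]
    refine Finset.sum_congr rfl fun i _ => ?_
    rw [map_mul, mul_comm]
    congr 1
    simp [restrictLine]
  have h2 := Polynomial.eq_C_of_natDegree_eq_zero
    (Polynomial.derivative_eq_zero.mp h1)
  have h3 := eval_restrictLine x y f 0
  rw [← eval_restrictLine, h2, Polynomial.eval_C]
  rw [h2, Polynomial.eval_C] at h3
  simpa using h3

lemma exists_eq_combination {p x y N : Fin 3 → ℂ} (hN : N ≠ 0) (hp : p ⬝ᵥ N = 0)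
    (hx : x ⬝ᵥ N = 0) (hy : y ⬝ᵥ N = 0) (hpx : crossProduct p x ≠ 0) :
    ∃ a b : ℂ, y = a • p + b • x := by
  have h0 : y ⬝ᵥ crossProduct p x = 0 := by
    have := smul_eq_dot_smul_cross y p x N
    rw [hp, hx, hy, zero_smul, zero_smul, zero_smul, add_zero, add_zero] at this
    exact (smul_eq_zero.mp this).resolve_right hN
  obtain ⟨k, hk⟩ := Function.ne_iff.mp hpx
  have hdet : p ⬝ᵥ crossProduct x (Pi.single k 1) ≠ 0 := by
    rw [triple_product_permutation, triple_product_permutation, single_one_dotProduct]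
    exact hk
  have h1 := dot_cross_smul_eq p x (Pi.single k 1) y
  rw [h0, zero_smul, add_zero] at h1
  refine ⟨(p ⬝ᵥ crossProduct x (Pi.single k 1))⁻¹ * (y ⬝ᵥ crossProduct x (Pi.single k 1)),
    (p ⬝ᵥ crossProduct x (Pi.single k 1))⁻¹ * (y ⬝ᵥ crossProduct (Pi.single k 1) p), ?_⟩
  rw [mul_smul, mul_smul, ← smul_add, ← h1, inv_smul_smul₀ hdet]

end Gradient

/-! ### Dual curves -/

section Dual

lemma mk_grad_mem_tangentLines {f : HPoly} {n : ℕ} (hf : f.IsHomogeneous n) {x : Fin 3 → ℂ}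
    (hx : x ≠ 0) (hfx : eval x f = 0) (hg : grad f x ≠ 0) :
    Projectivization.mk ℂ (grad f x) hg ∈ tangentLines (projZeros f) := by
  obtain ⟨a, ha⟩ := Projectivization.exists_smul_eq_mk_rep ℂ x hx
  have h1 : grad f (Projectivization.mk ℂ x hx : P2).rep = (a : ℂ) ^ (n - 1) • grad f x := by
    rw [← ha, Units.smul_def, grad_smul hf]
  have ha0 : (a : ℂ) ^ (n - 1) ≠ 0 := pow_ne_zero _ a.ne_zero
  have h2 : grad f (Projectivization.mk ℂ x hx : P2).rep ≠ 0 := by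
    rw [h1]; exact smul_ne_zero ha0 hg
  refine ⟨_, (mk_mem_projZeros hf hx).mpr hfx, f, n, hf, subset_rfl, h2, ?_⟩
  refine mk_eq_mk_of_cross_eq_zero hg h2 ?_
  rw [h1]
  simp

/-- An equation `g` vanishing on the curve is a multiple `P * a` of the component through `x`; at
`x` its gradient is `a x` times that of `P`. -/
lemma exists_of_mem_tangentLines {f : HPoly} {n : ℕ} (hf : f.IsHomogeneous n) (h0 : f ≠ 0)
    {S : Finset HPoly} (hS : ∀ P ∈ S, Irreducible P ∧ P ∣ f)
    (hSx : ∀ x, eval x f = 0 → ∃ P ∈ S, eval x P = 0) {l : P2}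
    (hl : l ∈ tangentLines (projZeros f)) :
    ∃ P ∈ S, ∃ x : P2, eval x.rep P = 0 ∧ ∃ h : grad P x.rep ≠ 0, l = Projectivization.mk ℂ _ h := by
  obtain ⟨x, hx, g, k, hg, hfg, hgx, rfl⟩ := hl
  obtain ⟨P, hP, hPx⟩ := hSx _ hx
  obtain ⟨m, -, hm⟩ := hf.of_dvd h0 (hS P hP).2
  obtain ⟨a, rfl⟩ : P ∣ g := by
    refine dvd_of_projZeros_subset hm hg (hS P hP).1 (subset_trans ?_ hfg)
    obtain ⟨b, rfl⟩ := (hS P hP).2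
    rw [projZeros_mul]
    exact Set.subset_union_left
  have h1 : grad (P * a) x.rep = eval x.rep a • grad P x.rep := grad_mul_of_eval_eq_zero hPx
  have h2 : grad P x.rep ≠ 0 := fun h => hgx (by
    change grad (P * a) x.rep = 0
    rw [h1, h, smul_zero])
  refine ⟨P, hP, x, hPx, h2, (Projectivization.mk_eq_mk_iff' ..).mpr ⟨eval x.rep a, ?_⟩⟩
  exact h1.symm

lemma exists_dual_equation_of_isHomogeneous {P : HPoly} {m : ℕ} (hP : P.IsHomogeneous m)
    (h0 : P ≠ 0) : ∃ (G : HPoly) (n : ℕ), G.IsHomogeneous n ∧ G ≠ 0 ∧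
      ∀ x, x ≠ 0 → eval x P = 0 → grad P x ≠ 0 → eval (grad P x) G = 0 := by
  have hj : ∀ j : Fin 3, ∃ (G : HPoly) (n : ℕ), G.IsHomogeneous n ∧ G ≠ 0 ∧
      ∀ x, x j ≠ 0 → eval x P = 0 → grad P x ≠ 0 → eval (grad P x) G = 0 := by
    intro j
    -- Multiplying the partial derivatives by `X j` raises their degree from `m - 1` to `m ≥ 1`.
    -- Rescaling `x` then reaches every multiple of the gradient, even when `P` is linear, so a
    -- homogeneous part of `G` can be used.
    obtain ⟨G, hG0, a, ha⟩ := exists_dvd_aeval h0 fun i => X j * pderiv i P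
    obtain ⟨l, hl⟩ := exists_homogeneousComponent_ne_zero hG0
    refine ⟨_, l, homogeneousComponent_isHomogeneous l G, hl, fun x hxj hx hg => ?_⟩
    have hm : m ≠ 0 := by
      rintro rfl
      apply hg
      rw [← totalDegree_zero_iff_isHomogeneous, totalDegree_eq_zero_iff_eq_C] at hP
      ext i
      rw [grad, hP]
      simp
    refine eval_homogeneousComponent_eq_zero (fun s _ => ?_) l
    obtain ⟨t, ht⟩ := IsAlgClosed.exists_pow_nat_eq (s / x j) (Nat.pos_of_ne_zero hm)
    have h1 := congrArg (eval (t • x)) ha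
    rw [eval_aeval_eq, map_mul, hP.eval_smul, hx, mul_zero, zero_mul] at h1
    refine Eq.trans ?_ h1
    congr 2 with i
    rw [map_mul, eval_X, hP.pderiv.eval_smul, Pi.smul_apply, Pi.smul_apply, smul_eq_mul,
      smul_eq_mul, mul_mul_mul_comm, ← pow_succ', Nat.sub_add_cancel (Nat.pos_of_ne_zero hm), ht]
    change s * eval x (pderiv i P) = _
    field_simp
  choose G n hGh hG0 hG using hj
  refine ⟨∏ j, G j, ∑ j, n j, IsHomogeneous.prod _ _ _ fun j _ => hGh j,
    Finset.prod_ne_zero_iff.mpr fun j _ => hG0 j, fun x hx hPx hg => ?_⟩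
  obtain ⟨j, hj⟩ := Function.ne_iff.mp hx
  rw [map_prod]
  exact Finset.prod_eq_zero (Finset.mem_univ j) (hG j x hj hPx hg)

lemma exists_dual_equation {f : HPoly} {n : ℕ} (hf : f.IsHomogeneous n) (h0 : f ≠ 0) :
    ∃ (G : HPoly) (m : ℕ), G.IsHomogeneous m ∧ G ≠ 0 ∧
      tangentLines (projZeros f) ⊆ projZeros G := by
  obtain ⟨S, hS, hSx⟩ := exists_irreducible_factors h0
  have hG : ∀ P : HPoly, ∃ (G : HPoly) (m : ℕ), P ∈ S → G.IsHomogeneous m ∧ G ≠ 0 ∧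
      ∀ x, x ≠ 0 → eval x P = 0 → grad P x ≠ 0 → eval (grad P x) G = 0 := by
    intro P
    by_cases hP : P ∈ S
    · obtain ⟨m, -, hm⟩ := hf.of_dvd h0 (hS P hP).2
      obtain ⟨G, k, h⟩ := exists_dual_equation_of_isHomogeneous hm (hS P hP).1.ne_zero
      exact ⟨G, k, fun _ => h⟩
    · exact ⟨0, 0, fun h => absurd h hP⟩
  choose G m hG using hG
  have hh : (∏ P ∈ S, G P).IsHomogeneous (∑ P ∈ S, m P) :=
    IsHomogeneous.prod _ _ _ fun P hP => (hG P hP).1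
  refine ⟨∏ P ∈ S, G P, ∑ P ∈ S, m P, hh,
    Finset.prod_ne_zero_iff.mpr fun P hP => (hG P hP).2.1, fun l hl => ?_⟩
  obtain ⟨P, hP, x, hx, hg, rfl⟩ := exists_of_mem_tangentLines hf h0 hS hSx hl
  rw [mk_mem_projZeros hh, map_prod]
  exact Finset.prod_eq_zero hP ((hG P hP).2.2 _ x.rep_nonzero hx hg)

/-- A tangent line of `P = 0` passes through `p` when the derivative of `P` along `p` vanishes at
the point of contact. That derivative is nonzero of smaller degree, so it is not divisible by `P`.
-/
lemma finite_tangentLines_inter {f : HPoly} {n : ℕ} (hf : f.IsHomogeneous n) (h0 : f ≠ 0)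
    {p : Fin 3 → ℂ} (hp : ∀ P, Irreducible P → P ∣ f → ∑ i, C (p i) * pderiv i P ≠ 0) :
    (tangentLines (projZeros f) ∩ projZeros (linForm p)).Finite := by
  classical
  obtain ⟨S, hS, hSx⟩ := exists_irreducible_factors h0
  -- The value `x` at a vanishing gradient is arbitrary and never used.
  set φ : HPoly → P2 → P2 := fun P x =>
    if h : grad P x.rep ≠ 0 then Projectivization.mk ℂ _ h else x with hφ
  have hcov : tangentLines (projZeros f) ∩ projZeros (linForm p) ⊆
      ⋃ P ∈ S, φ P '' (projZeros P ∩ projZeros (∑ i, C (p i) * pderiv i P)) := by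
    rintro l ⟨hl, hlp⟩
    obtain ⟨P, hP, x, hx, hg, rfl⟩ := exists_of_mem_tangentLines hf h0 hS hSx hl
    refine Set.mem_biUnion (Finset.mem_coe.mpr hP) ⟨x, ⟨hx, ?_⟩, by simp only [hφ, dif_pos hg]⟩
    rw [mk_mem_projZeros (linForm_isHomogeneous p), eval_linForm] at hlp
    simpa [projZeros, dotProduct, grad] using hlp
  refine (S.finite_toSet.biUnion fun P hP => Set.Finite.image _ ?_).subset hcov
  obtain ⟨hirr, hdvd⟩ := hS P hP
  obtain ⟨m, -, hm⟩ := hf.of_dvd h0 hdvd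
  have hD : (∑ i, C (p i) * pderiv i P).IsHomogeneous (m - 1) :=
    IsHomogeneous.sum _ _ _ fun i _ => hm.pderiv.C_mul _
  refine finite_projZeros_inter hm hD hirr fun hdv => ?_
  have hD0 := hp P hirr hdvd
  obtain ⟨k, hk, hk'⟩ := hD.of_dvd hD0 hdv
  have hkm := hm.inj_right hk' hirr.ne_zero
  obtain rfl : m = 0 := by omega
  apply hD0
  rw [← totalDegree_zero_iff_isHomogeneous, totalDegree_eq_zero_iff_eq_C] at hm
  rw [hm]
  simp

end Dual

/-! ### Branches of the strict transform and limits of tangent lines -/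

section Branch

lemma hasStrictFDerivAt_eval (G : MvPolynomial (Fin 2) ℂ) (z : ℂ × ℂ) :
    HasStrictFDerivAt (fun z : ℂ × ℂ => eval ![z.1, z.2] G)
      (eval ![z.1, z.2] (pderiv 0 G) • ContinuousLinearMap.fst ℂ ℂ ℂ +
        eval ![z.1, z.2] (pderiv 1 G) • ContinuousLinearMap.snd ℂ ℂ ℂ) z := by
  induction G using MvPolynomial.induction_on with
  | C c =>
    simp only [eval_C, pderiv_C, map_zero]
    refine (hasStrictFDerivAt_const (𝕜 := ℂ) c z).congr_fderiv ?_
    ext <;> simp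
  | add p q hp hq =>
    simp only [map_add]
    refine (hp.add hq).congr_fderiv ?_
    module
  | mul_X p i hp =>
    simp only [map_mul, eval_X, Derivation.leibniz, map_add, smul_eq_mul]
    fin_cases i
    · refine (hp.mul (hasStrictFDerivAt_fst (p := z))).congr_fderiv ?_
      simp [pderiv_X]
      module
    · refine (hp.mul (hasStrictFDerivAt_snd (p := z))).congr_fderiv ?_
      simp [pderiv_X]
      module

lemma continuous_eval_pair (G : MvPolynomial (Fin 2) ℂ) :
    Continuous fun z : ℂ × ℂ => eval ![z.1, z.2] G :=
  continuous_iff_continuousAt.mpr fun z => (hasStrictFDerivAt_eval G z).continuousAt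

/-- Near a point where `∂G/∂y ≠ 0`, the curve `G = 0` meets all vertical lines. -/
lemma eventually_exists_eval_eq_zero {G : MvPolynomial (Fin 2) ℂ} (h0 : eval ![0, 0] G = 0)
    (h1 : eval ![0, 0] (pderiv 1 G) ≠ 0) {U : Set (ℂ × ℂ)} (hU : U ∈ nhds ((0, 0) : ℂ × ℂ)) :
    ∀ᶠ x in nhds (0 : ℂ), ∃ y, (x, y) ∈ U ∧ eval ![x, y] G = 0 := by
  -- The map `(x, y) ↦ (x, G (x, y))` has surjective derivative at the origin, hence is open there;
  -- the points `(x, 0)` are hit for small `x`.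
  have hd := (hasStrictFDerivAt_fst (𝕜 := ℂ) (p := ((0, 0) : ℂ × ℂ))).prodMk
    (hasStrictFDerivAt_eval G (0, 0))
  have hm := hd.map_nhds_eq_of_surj <| by
    rw [LinearMap.range_eq_top]
    rintro ⟨a, b⟩
    refine ⟨(a, (eval ![0, 0] (pderiv 1 G))⁻¹ * (b - eval ![0, 0] (pderiv 0 G) * a)), ?_⟩
    simp [mul_inv_cancel_left₀ h1]
  have himg := Filter.image_mem_map (m := fun z : ℂ × ℂ => (z.1, eval ![z.1, z.2] G)) hU
  rw [hm] at himg
  simp only [h0] at himg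
  have hc : ContinuousAt (fun x : ℂ => (x, (0 : ℂ))) 0 := by fun_prop
  filter_upwards [hc.preimage_mem_nhds himg] with x hx
  obtain ⟨⟨x', y⟩, hU', hxy⟩ := hx
  simp only [Prod.mk.injEq] at hxy
  obtain ⟨rfl, hxy⟩ := hxy
  exact ⟨y, hU', hxy⟩

end Branch

section Branch

lemma exists_eq_smul_of_cross_rep_eq_zero {N c : Fin 3 → ℂ} {s : P2} (hN : N ≠ 0)
    (h : s = Projectivization.mk ℂ N hN) (hc : crossProduct s.rep c = 0) :
    ∃ μ : ℂ, c = μ • N := by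
  obtain ⟨a, ha⟩ := Projectivization.exists_smul_eq_mk_rep ℂ N hN
  rw [h, ← ha, Units.smul_def, map_smul, LinearMap.smul_apply, smul_eq_zero] at hc
  have h1 := hc.resolve_left a.ne_zero
  by_contra! hne
  refine crossProduct_ne_zero_iff_linearIndependent.mpr ?_ h1
  rw [LinearIndependent.pair_iff' hN]
  exact fun b hb => hne b hb.symm

/-- At a point of the strict transform `G = 0` of the curve `f = 0` in the blow-up chart at `q`, a
vector proportional to the gradient of `f`; see `smul_grad_eq_conormal`. -/
def conormal (q u v : Fin 3 → ℂ) (G : MvPolynomial (Fin 2) ℂ) (z : ℂ × ℂ) : Fin 3 → ℂ :=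
  (-(z.1 * (z.1 * eval ![z.1, z.2] (pderiv 0 G)))) • crossProduct u v +
    (z.1 * eval ![z.1, z.2] (pderiv 0 G) - z.2 * eval ![z.1, z.2] (pderiv 1 G)) •
      crossProduct v q + eval ![z.1, z.2] (pderiv 1 G) • crossProduct q u

lemma continuous_conormal (q u v : Fin 3 → ℂ) (G : MvPolynomial (Fin 2) ℂ) :
    Continuous (conormal q u v G) := by
  have h0 := continuous_eval_pair (pderiv 0 G)
  have h1 := continuous_eval_pair (pderiv 1 G)
  have hb := continuous_fst.mul h0
  exact ((((continuous_fst.mul hb).neg.smul continuous_const).add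
    ((hb.sub (continuous_snd.mul h1)).smul continuous_const)).add (h1.smul continuous_const))

lemma conormal_zero (q u v : Fin 3 → ℂ) (G : MvPolynomial (Fin 2) ℂ) :
    conormal q u v G (0, 0) = eval ![0, 0] (pderiv 1 G) • crossProduct q u := by
  simp [conormal]

lemma eval_blowupChart (q u v : Fin 3 → ℂ) (x y : ℂ) :
    (fun i => eval ![x, y] (blowupChart q u v i)) = q + x • u + (x * y) • v := by
  ext i; simp [blowupChart]

lemma eval_pderiv_aeval_blowupChart (q u v : Fin 3 → ℂ) (x y : ℂ) (f : HPoly) (j : Fin 2) :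
    eval ![x, y] (pderiv j (aeval (blowupChart q u v) f)) =
      ∑ i, grad f (q + x • u + (x * y) • v) i * eval ![x, y] (pderiv j (blowupChart q u v i)) := by
  rw [derivation_aeval, map_sum]
  refine Finset.sum_congr rfl fun i _ => ?_
  rw [map_mul, eval_aeval_eq, eval_blowupChart]
  rfl

lemma eval_pderiv_pow_mul {G : MvPolynomial (Fin 2) ℂ} {x y : ℂ} (h : eval ![x, y] G = 0) (k : ℕ)
    (j : Fin 2) : eval ![x, y] (pderiv j (X 0 ^ k * G)) = x ^ k * eval ![x, y] (pderiv j G) := by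
  simp [Derivation.leibniz, h]

/-- The chain rule for `f ∘ chart = x^k G` gives the values of the gradient on `u + y v` and `x v`;
Euler's identity at the point gives the value on `q`. These determine the covector. -/
lemma smul_grad_eq_conormal {f : HPoly} {n : ℕ} (hf : f.IsHomogeneous n) {q u v : Fin 3 → ℂ}
    {G : MvPolynomial (Fin 2) ℂ} {k : ℕ} (hE : aeval (blowupChart q u v) f = X 0 ^ k * G) {x y : ℂ}
    (hGxy : eval ![x, y] G = 0) (hfx : eval (q + x • u + (x * y) • v) f = 0) :
    ((q ⬝ᵥ crossProduct u v) * x) • grad f (q + x • u + (x * y) • v) =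
      x ^ k • conormal q u v G (x, y) := by
  have h0 := eval_pderiv_aeval_blowupChart q u v x y f 0
  have h1 := eval_pderiv_aeval_blowupChart q u v x y f 1
  have hM := dot_grad hf (q + x • u + (x * y) • v)
  rw [hE, eval_pderiv_pow_mul hGxy] at h0 h1
  rw [hfx, mul_zero] at hM
  generalize grad f (q + x • u + (x * y) • v) = M at h0 h1 hM ⊢
  have hM0 : (u + y • v) ⬝ᵥ M = x ^ k * eval ![x, y] (pderiv 0 G) := by
    rw [h0]
    simp [pderiv_zero_blowupChart, lineParam, dotProduct, mul_comm]
  have hM1 : x * (v ⬝ᵥ M) = x ^ k * eval ![x, y] (pderiv 1 G) := by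
    rw [h1]
    simp only [pderiv_one_blowupChart, dotProduct, Finset.mul_sum, map_mul, eval_X, eval_C]
    refine Finset.sum_congr rfl fun i _ => ?_
    simp
    ring
  rw [add_dotProduct, smul_dotProduct, smul_eq_mul] at hM0
  rw [add_dotProduct, add_dotProduct, smul_dotProduct, smul_dotProduct, smul_eq_mul,
    smul_eq_mul] at hM
  have hMu : x * (u ⬝ᵥ M) =
      x ^ k * (x * eval ![x, y] (pderiv 0 G) - y * eval ![x, y] (pderiv 1 G)) := by
    linear_combination x * hM0 - y * hM1
  have hMq : x * (q ⬝ᵥ M) = x ^ k * (-(x * (x * eval ![x, y] (pderiv 0 G)))) := by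
    linear_combination x * hM - x * hMu - x * y * hM1
  rw [mul_comm, mul_smul, smul_eq_dot_smul_cross q u v M, smul_add, smul_add, smul_smul,
    smul_smul, smul_smul, hMq, hMu, hM1]
  simp only [conormal, smul_add, smul_smul]

/-- Because `c` kills `u`, `c (u + y v) = y c v`: a linear factor occurring once over `u` gives a
simple zero at `y = 0` on the exceptional divisor. -/
lemma eval_pderiv_one_aeval_lineParam {c u v : Fin 3 → ℂ} (hcu : u ⬝ᵥ c = 0) (H : HPoly)
    (E : MvPolynomial (Fin 2) ℂ) :
    eval ![0, 0] (aeval (lineParam u v) (linForm c * H) + X 0 * E) = 0 ∧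
    eval ![0, 0] (pderiv 1 (aeval (lineParam u v) (linForm c * H) + X 0 * E)) =
      (v ⬝ᵥ c) * eval u H := by
  have hlin : aeval (lineParam u v) (linForm c) = X 1 * C (v ⬝ᵥ c) := by
    refine MvPolynomial.funext fun z => ?_
    have hz : z = ![z 0, z 1] := by ext i; fin_cases i <;> rfl
    rw [hz, eval_aeval_lineParam, eval_linForm, dotProduct_comm, add_dotProduct, hcu,
      smul_dotProduct]
    simp
  have h1 : eval ![0, 0] (aeval (lineParam u v) H) = eval u H := by
    rw [eval_aeval_lineParam, zero_smul, add_zero]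
  rw [map_mul, hlin]
  generalize aeval (lineParam u v) H = H' at h1 ⊢
  constructor
  · simp
  · simp [Derivation.leibniz, pderiv_X, h1, mul_comm]

/-- The tangent lines of `f = 0` along a branch through `q` that is tangent to the line `c`, but not
contained in it, are infinitely many and tend to `c`, so that `c` lies on the one-dimensional part of
the dual curve. -/
lemma eval_eq_zero_of_hasTransverseFactor {f : HPoly} {n : ℕ} (hf : f.IsHomogeneous n)
    {q u c : Fin 3 → ℂ} (hqu : crossProduct q u ≠ 0) (hc : c ≠ 0) (hcq : q ⬝ᵥ c = 0)
    (hcu : u ⬝ᵥ c = 0) (hT : HasTransverseFactor f q u c) {g : HPoly} {l : ℕ}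
    (hg : g.IsHomogeneous l) {S : Set P2} (hS : S.Finite)
    (hTS : tangentLines (projZeros f) ⊆ projZeros g ∪ S)
    (hline : ∃ s : ℂ, eval (q + s • u) f ≠ 0) : eval c g = 0 := by
  obtain ⟨v, hcv⟩ : ∃ v : Fin 3 → ℂ, v ⬝ᵥ c ≠ 0 := by
    obtain ⟨j, hj⟩ := Function.ne_iff.mp hc
    exact ⟨Pi.single j 1, by rwa [single_one_dotProduct]⟩
  have hdc := smul_eq_dot_smul_cross q u v c
  rw [hcq, hcu, zero_smul, zero_smul, zero_add, zero_add] at hdc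
  have hdet : q ⬝ᵥ crossProduct u v ≠ 0 := fun h0 => by
    rw [h0, zero_smul] at hdc
    exact smul_ne_zero hcv hqu hdc.symm
  obtain ⟨k, H, hlow, hk, hHu⟩ := hT
  obtain ⟨E, hE⟩ := exists_aeval_blowupChart_eq hlow u v
  obtain ⟨hG0, hG1⟩ := eval_pderiv_one_aeval_lineParam (v := v) hcu H E
  rw [hk] at hE
  generalize aeval (lineParam u v) (linForm c * H) + X 0 * E = G at hE hG0 hG1
  have hNcont := continuous_conormal q u v G
  have hN0 : conormal q u v G (0, 0) = ((q ⬝ᵥ crossProduct u v) * eval u H) • c := by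
    rw [conormal_zero, hG1, mul_comm (v ⬝ᵥ c), mul_smul, ← hdc, smul_smul, mul_comm (eval u H)]
  have hdH : (q ⬝ᵥ crossProduct u v) * eval u H ≠ 0 := mul_ne_zero hdet hHu
  by_contra hgc
  -- At the origin the conormal is a nonzero multiple of `c`. If `g` does not vanish at `c`, then
  -- nearby conormals avoid `g = 0` and every point of `S` other than `c`.
  have hev : ∀ᶠ z in nhds ((0, 0) : ℂ × ℂ), conormal q u v G z ≠ 0 ∧
      eval (conormal q u v G z) g ≠ 0 ∧
      ∀ s ∈ S, crossProduct s.rep c ≠ 0 → crossProduct s.rep (conormal q u v G z) ≠ 0 := by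
    refine (hNcont.continuousAt.eventually_ne ?_).and (Filter.Eventually.and ?_ ?_)
    · rw [hN0]; exact smul_ne_zero hdH hc
    · have hgcont : Continuous fun z => eval (conormal q u v G z) g :=
        (MvPolynomial.continuous_eval g).comp hNcont
      refine hgcont.continuousAt.eventually_ne ?_
      rw [hN0, hg.eval_smul]
      exact mul_ne_zero (pow_ne_zero _ hdH) hgc
    · rw [Filter.eventually_all_finite hS]
      intro s _
      by_cases hs : crossProduct s.rep c = 0
      · exact Filter.Eventually.of_forall fun _ h => absurd hs h
      · have hcc : Continuous fun z => crossProduct s.rep (conormal q u v G z) :=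
          (LinearMap.continuous_of_finiteDimensional (crossProduct s.rep)).comp hNcont
        have hne : crossProduct s.rep (conormal q u v G (0, 0)) ≠ 0 := by
          rw [hN0, map_smul]; exact smul_ne_zero hdH hs
        filter_upwards [hcc.continuousAt.eventually_ne hne] with z hz _ using hz
  have hG1' : eval ![0, 0] (pderiv 1 G) ≠ 0 := by rw [hG1]; exact mul_ne_zero hcv hHu
  have hzero : ∀ᶠ x in nhds (0 : ℂ), x ≠ 0 → eval (q + x • u) f = 0 := by
    filter_upwards [eventually_exists_eval_eq_zero hG0 hG1' hev] with x hx hx0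
    obtain ⟨y, ⟨hNz, hgN, hSN⟩, hGxy⟩ := hx
    have hfx : eval (q + x • u + (x * y) • v) f = 0 := by
      have := congrArg (eval ![x, y]) hE
      rwa [eval_aeval_eq, map_mul, hGxy, mul_zero, eval_blowupChart] at this
    have hMN := smul_grad_eq_conormal hf hE hGxy hfx
    have hMx : (q + x • u + (x * y) • v) ⬝ᵥ grad f (q + x • u + (x * y) • v) = 0 := by
      rw [dot_grad hf, hfx, mul_zero]
    have hx0' : q + x • u + (x * y) • v ≠ 0 := fun h0 => hdet <| by
      have h1 : (q + x • u + (x * y) • v) ⬝ᵥ crossProduct u v = q ⬝ᵥ crossProduct u v := by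
        rw [add_dotProduct, add_dotProduct, smul_dotProduct, smul_dotProduct, dot_self_cross,
          dot_cross_self, smul_zero, smul_zero, add_zero, add_zero]
      rw [← h1, h0, zero_dotProduct]
    have hxk : x ^ k ≠ 0 := pow_ne_zero _ hx0
    have hMne : grad f (q + x • u + (x * y) • v) ≠ 0 := fun h0 => by
      rw [h0, smul_zero] at hMN
      exact smul_ne_zero hxk hNz hMN.symm
    have hmk : (Projectivization.mk ℂ _ hMne : P2) = Projectivization.mk ℂ _ hNz := by
      refine (Projectivization.mk_eq_mk_iff' ..).mpr
        ⟨((q ⬝ᵥ crossProduct u v) * x)⁻¹ * x ^ k, ?_⟩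
      rw [mul_smul, ← hMN, inv_smul_smul₀ (mul_ne_zero hdet hx0)]
    have hmem := mk_grad_mem_tangentLines hf hx0' hfx hMne
    rw [hmk] at hmem
    rcases hTS hmem with hmem | hmem
    · exact absurd ((mk_mem_projZeros hg hNz).mp hmem) hgN
    -- The nearby tangent line therefore must be `c` itself. Its point of contact then lies on `c`,
    -- which forces `y = 0`.
    · have hcross : crossProduct (Projectivization.mk ℂ _ hNz : P2).rep c = 0 := by
        by_contra hne
        refine hSN _ hmem hne ?_
        obtain ⟨a, ha⟩ := Projectivization.exists_smul_eq_mk_rep ℂ _ hNz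
        rw [← ha]
        simp [Units.smul_def]
      obtain ⟨μ, hμ⟩ := exists_eq_smul_of_cross_rep_eq_zero hNz rfl hcross
      have hNx : (q + x • u + (x * y) • v) ⬝ᵥ conormal q u v G (x, y) = 0 := by
        have h1 : (q + x • u + (x * y) • v) ⬝ᵥ (x ^ k • conormal q u v G (x, y)) = 0 := by
          rw [← hMN, dotProduct_smul, hMx, smul_zero]
        rw [dotProduct_smul, smul_eq_mul] at h1
        exact (mul_eq_zero.mp h1).resolve_left hxk
      have hcx : (q + x • u + (x * y) • v) ⬝ᵥ c = 0 := by
        rw [hμ, dotProduct_smul, hNx, smul_zero]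
      rw [add_dotProduct, add_dotProduct, smul_dotProduct, smul_dotProduct, hcq, hcu,
        smul_zero, zero_add, zero_add, smul_eq_mul] at hcx
      have hy : y = 0 := by
        rcases mul_eq_zero.mp hcx with h | h
        · exact (mul_eq_zero.mp h).resolve_left hx0
        · exact absurd h hcv
      rwa [hy, mul_zero, zero_smul, add_zero] at hfx
  -- The branch would lie in the line through `q` and `u`, which `hline` excludes.
  have hrestr : restrictLine q u f = 0 := by
    apply Polynomial.eq_zero_of_infinite_isRoot
    have h1 : {x : ℂ | x ≠ 0 → eval (q + x • u) f = 0}.Infinite := infinite_of_mem_nhds 0 hzero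
    refine (h1.sdiff (Set.finite_singleton 0)).mono fun x hx => ?_
    simpa [eval_restrictLine] using hx.1 hx.2
  obtain ⟨s, hs⟩ := hline
  rw [← eval_restrictLine, hrestr, Polynomial.eval_zero] at hs
  exact hs rfl

end Branch

/-! ### Intersection of the dual curve with a pencil -/

section Counting

/-- A curve of degree `n` that does not contain a line meets it in at most `n` points. -/
lemma encard_le_of_subset_line {g : HPoly} {n : ℕ} (hg : g.IsHomogeneous n) {p : Fin 3 → ℂ}
    (hp : p ≠ 0) (hline : ¬ projZeros (linForm p) ⊆ projZeros g) {B : Set P2}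
    (hB : B ⊆ projZeros (linForm p) ∩ projZeros g) : B.encard ≤ n := by
  obtain ⟨a, hap, hag⟩ := Set.not_subset.mp hline
  rcases B.eq_empty_or_nonempty with rfl | ⟨b, hb⟩
  · simp
  have hlin : ∀ l : P2, l ∈ projZeros (linForm p) → l.rep ⬝ᵥ p = 0 := fun l hl => by
    rw [dotProduct_comm, ← eval_linForm]; exact hl
  -- The point `a` of the line, off the curve, serves as the point at infinity; the remaining points
  -- are `b + t a`, and those on the curve are roots of the restriction.
  have hab : crossProduct a.rep b.rep ≠ 0 := fun h0 =>
    hag (eq_of_cross_rep_eq_zero h0 ▸ (hB hb).2)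
  have hcomb : ∀ l ∈ B, ∃ t s : ℂ, s ≠ 0 ∧ l.rep = s • (b.rep + t • a.rep) := by
    intro l hl
    obtain ⟨α, β, hαβ⟩ := exists_eq_combination hp (hlin a hap) (hlin b (hB hb).1)
      (hlin l (hB hl).1) hab
    have hβ : β ≠ 0 := by
      rintro rfl
      rw [zero_smul, add_zero] at hαβ
      have h1 : eval l.rep g = 0 := (hB hl).2
      rw [hαβ, hg.eval_smul] at h1
      rcases mul_eq_zero.mp h1 with h1 | h1
      · refine pow_ne_zero n (fun hα : α = 0 => l.rep_nonzero ?_) h1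
        rw [hαβ, hα, zero_smul]
      · exact hag h1
    refine ⟨β⁻¹ * α, β, hβ, ?_⟩
    rw [smul_add, smul_smul, mul_inv_cancel_left₀ hβ, hαβ, add_comm]
  set Ψ := restrictLine b.rep a.rep g with hΨ
  have hΨ0 : Ψ ≠ 0 := by
    intro h0
    refine hag (eval_eq_zero_of_forall_ne_zero (y := b.rep) fun s hs => ?_)
    have h1 := eval_restrictLine b.rep a.rep g s⁻¹
    rw [← hΨ, h0, Polynomial.eval_zero] at h1
    have h2 : a.rep + s • b.rep = s • (b.rep + s⁻¹ • a.rep) := by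
      rw [smul_add, smul_inv_smul₀ hs, add_comm]
    rw [h2, hg.eval_smul, ← h1, mul_zero]
  have hdeg : Ψ.natDegree ≤ n := by
    have := aeval_natDegree_le (n := 1) g hg.totalDegree_le
      (fun i => Polynomial.C (b.rep i) + Polynomial.C (a.rep i) * Polynomial.X) fun i => by
        compute_degree
    rwa [mul_one] at this
  choose! t s hs hts using hcomb
  have hmaps : Set.MapsTo t B (Ψ.roots.toFinset : Set ℂ) := by
    intro l hl
    rw [Finset.mem_coe, Multiset.mem_toFinset, Polynomial.mem_roots hΨ0, Polynomial.IsRoot,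
      eval_restrictLine]
    have h1 : eval l.rep g = 0 := (hB hl).2
    rw [hts l hl, hg.eval_smul] at h1
    exact (mul_eq_zero.mp h1).resolve_left (pow_ne_zero _ (hs l hl))
  have hinj : Set.InjOn t B := by
    intro l hl l' hl' h
    apply eq_of_cross_rep_eq_zero
    rw [hts l hl, hts l' hl', h]
    simp only [map_smul, LinearMap.smul_apply, cross_self, smul_zero]
  calc B.encard ≤ (Ψ.roots.toFinset : Set ℂ).encard := Set.encard_le_encard_of_injOn hmaps hinj
    _ = Ψ.roots.toFinset.card := Set.encard_coe_eq_coe_finsetCard _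
    _ ≤ n := by
      exact_mod_cast (Multiset.toFinset_card_le _).trans ((Polynomial.card_roots' _).trans hdeg)

/-- A pencil of lines of which only finitely many belong to `T` is not contained in a curve that
makes up the closure of `T` up to finitely many points. -/
lemma not_projZeros_linForm_subset {T : Set P2} {g : HPoly} {n : ℕ} (hg : g.IsHomogeneous n)
    (hsq : Squarefree g) (hgT : projZeros g ⊆ zariskiClosure T)
    (hfin : (zariskiClosure T \ projZeros g).Finite) {p : Fin 3 → ℂ} (hp : p ≠ 0)
    (hTp : (T ∩ projZeros (linForm p)).Finite) : ¬ projZeros (linForm p) ⊆ projZeros g := by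
  intro hsub
  have hirr := linForm_irreducible hp
  obtain ⟨g', rfl⟩ := dvd_of_projZeros_subset (linForm_isHomogeneous p) hg hirr hsub
  obtain ⟨m, -, hg'⟩ := hg.of_dvd hsq.ne_zero (dvd_mul_left g' _)
  -- If the pencil were a component of `g`, removing one copy would still leave an equation for `T`
  -- up to finitely many points. The pencil would divide `g'` as well, against squarefreeness.
  have hT : T ⊆ projZeros g' ∪ ((zariskiClosure T \ projZeros (linForm p * g')) ∪
      (T ∩ projZeros (linForm p))) := by
    intro x hx
    by_cases h1 : x ∈ projZeros (linForm p * g')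
    · rw [projZeros_mul] at h1
      rcases h1 with h1 | h1
      · exact Or.inr (Or.inr ⟨hx, h1⟩)
      · exact Or.inl h1
    · exact Or.inr (Or.inl ⟨subset_zariskiClosure T hx, h1⟩)
  have hcl := zariskiClosure_subset_union hg' (hfin.union hTp) hT
  obtain ⟨r, rfl⟩ := dvd_of_projZeros_subset_union (linForm_isHomogeneous p) hg' hirr
    (hfin.union hTp) ((hsub.trans hgT).trans hcl)
  exact hirr.not_isUnit (hsq _ ⟨r, by ring⟩)

end Counting

/-! ### The polar curve with general centre and the final count -/

namespace PlaneFoliation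

variable {d : ℕ} (F : PlaneFoliation d)

/-- At `p + s x` the 1-form kills `p` by hypothesis and `p + s x` by the Euler relation, hence `x`
when `s ≠ 0`; then `s → 0`. A line through `p` inside the polar is thus the tangent line at `p`. -/
lemma dot_val_eq_zero_of_line {p x : Fin 3 → ℂ}
    (h : ∀ s : ℂ, s ≠ 0 → eval (p + s • x) (F.polarForm p) = 0) : x ⬝ᵥ F.val p = 0 := by
  rw [← eval_polarForm]
  refine eval_eq_zero_of_forall_ne_zero (y := x) fun s hs => ?_
  have h1 := F.dot_val (p + s • x)
  have h2 := h s hs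
  rw [eval_polarForm] at h2 ⊢
  rw [add_dotProduct, h2, zero_add, smul_dotProduct, smul_eq_mul] at h1
  exact (mul_eq_zero.mp h1).resolve_left hs

lemma eval_polarForm_self (p : Fin 3 → ℂ) : eval p (F.polarForm p) = 0 := by
  rw [eval_polarForm, dot_val]

/-- When the tangent line at `p` is not invariant, no component of the polar curve with centre `p`
is a line through `p`. -/
lemma sum_pderiv_ne_zero_of_dvd_polarForm {p : P2} (hp : F.val p.rep ≠ 0)
    (hd : F.polarForm p.rep ≠ 0) {y : Fin 3 → ℂ} (hy : F.val p.rep ⬝ᵥ y = 0)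
    (hy' : eval y (F.polarForm p.rep) ≠ 0) {P : HPoly} (hP : Irreducible P)
    (hdvd : P ∣ F.polarForm p.rep) : ∑ i, C (p.rep i) * pderiv i P ≠ 0 := by
  intro h0
  obtain ⟨m, -, hm⟩ := (F.polarForm_isHomogeneous p.rep).of_dvd hd hdvd
  obtain ⟨x, hxP, hxp⟩ : ∃ x ∈ projZeros P, x ≠ p := by
    by_contra! h
    have hsub : projZeros P ⊆ projZeros 1 ∪ {p} := fun x hx => Or.inr (h x hx)
    exact hP.not_isUnit (isUnit_of_dvd_one (dvd_of_projZeros_subset_union hm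
      (isHomogeneous_one _ _) hP (Set.finite_singleton p) hsub))
  have hpx : crossProduct p.rep x.rep ≠ 0 := fun h => hxp (eq_of_cross_rep_eq_zero h).symm
  have hx : eval x.rep P = 0 := hxP
  -- A zero derivative along `p` makes `P` invariant under translation by `p`, so its zero set
  -- contains the whole line joining `x` to `p`. That line would be the tangent line, on which the
  -- polar is nonzero at `y`.
  have hP1 : ∀ a b : ℂ, b ≠ 0 → eval (a • p.rep + b • x.rep) P = 0 := by
    intro a b hb
    have h1 : a • p.rep + b • x.rep = b • (x.rep + (b⁻¹ * a) • p.rep) := by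
      rw [smul_add, smul_smul, mul_inv_cancel_left₀ hb, add_comm]
    rw [h1, hm.eval_smul, eval_add_smul_of_derivative_eq_zero h0, hx, mul_zero]
  have hP2 : ∀ a b : ℂ, eval (a • p.rep + b • x.rep) P = 0 := by
    intro a b
    by_cases hb : b = 0
    · rw [hb, zero_smul, add_zero]
      exact eval_eq_zero_of_forall_ne_zero (y := x.rep) fun t ht => hP1 a t ht
    · exact hP1 a b hb
  obtain ⟨Q, hQ⟩ := hdvd
  have hline : ∀ a b : ℂ, eval (a • p.rep + b • x.rep) (F.polarForm p.rep) = 0 := by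
    intro a b
    rw [hQ, map_mul, hP2, zero_mul]
  have hxt : x.rep ⬝ᵥ F.val p.rep = 0 :=
    F.dot_val_eq_zero_of_line fun s _ => by simpa using hline 1 s
  obtain ⟨a, b, rfl⟩ := exists_eq_combination hp (F.dot_val p.rep) hxt
    (by rwa [dotProduct_comm]) hpx
  exact hy' (hline a b)

/-- The polar curve with centre `p` passes through `p`, with the tangent line of the foliation. -/
lemma hasTransverseFactor_polarForm_self (p u : Fin 3 → ℂ) :
    HasTransverseFactor (F.polarForm p) p u (F.val p) := by
  have key : ∀ z, restrictRay z (shift p (F.polarForm p)) =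
      - (Polynomial.X * ∑ i, Polynomial.C (z i) * restrictRay z (shift p (F.form i))) := by
    intro z
    have h1 := congrArg (fun f => restrictRay z (shift p f)) F.euler
    have hX : ∀ i, restrictRay z (shift p (X i)) = Polynomial.C (z i) * Polynomial.X +
        Polynomial.C (p i) := fun i => by simp [shift, restrictRay]
    have hC : ∀ c, restrictRay z (shift p (C c)) = Polynomial.C c := fun c => by
      simp [shift, restrictRay]
    simp only [map_sum, map_mul, map_zero, hX] at h1
    rw [eq_neg_iff_add_eq_zero, ← h1, polarForm, map_sum, map_sum, Finset.mul_sum,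
      ← Finset.sum_add_distrib]
    refine Finset.sum_congr rfl fun i _ => ?_
    rw [map_mul, map_mul, hC]
    ring
  -- By the Euler relation at `p + z`, the polar equals `-∑ z_i ω_i (p + z)`, whose linear part is
  -- minus the form `F.val p`; hence degree `1` and cofactor `-1`.
  refine ⟨1, -1, fun m hm => ?_, ?_, by simp⟩
  · obtain rfl : m = 0 := by omega
    refine MvPolynomial.funext fun z => ?_
    rw [← coeff_restrictRay, key, Polynomial.coeff_neg, Polynomial.mul_coeff_zero]
    simp
  · refine MvPolynomial.funext fun z => ?_
    have h0 : ∀ i, (restrictRay z (shift p (F.form i))).coeff 0 = F.val p i := by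
      intro i
      rw [Polynomial.coeff_zero_eq_eval_zero, eval_restrictRay, eval_shift, zero_smul, zero_add]
      rfl
    rw [← coeff_restrictRay, key, Polynomial.coeff_neg, Polynomial.coeff_X_mul,
      Polynomial.finsetSum_coeff]
    simp only [Polynomial.coeff_C_mul, h0, eval_linForm, map_neg, dotProduct,
      mul_comm, neg_one_mul]

/-- The count of quasi-radial singularities for a centre `p` in general position. -/
lemma exists_hasCurveDegree_of_general (hd : 1 ≤ d) {p : P2} (hp : F.val p.rep ≠ 0)
    {y : Fin 3 → ℂ} (hy : F.val p.rep ⬝ᵥ y = 0) (hy' : eval y (F.polar p) ≠ 0)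
    (hqp : ∀ q ∈ F.sing, p ≠ q)
    (hbr : ∀ q, F.IsQuasiRadial q →
      HasTransverseFactor (F.polar p) q.rep p.rep (crossProduct q.rep p.rep))
    (htan : ∀ q ∈ F.sing, q.rep ⬝ᵥ F.val p.rep ≠ 0)
    (hcol : ∀ q ∈ F.sing, ∀ q' ∈ F.sing, q ≠ q' → crossProduct q.rep q'.rep ⬝ᵥ p.rep ≠ 0) :
    ∃ n : ℕ, HasCurveDegree (dualCurve (projZeros (F.polar p))) n ∧
      {q : P2 | F.IsQuasiRadial q}.encard + 1 ≤ (n : ℕ∞) := by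
  classical
  have hF0 : F.polar p ≠ 0 := F.polarForm_ne_zero hd p.rep_nonzero
  have hFh : (F.polar p).IsHomogeneous (d + 1) := F.polarForm_isHomogeneous p.rep
  obtain ⟨G, m, hG, hG0, hGT⟩ := exists_dual_equation hFh hF0
  obtain ⟨n, hn⟩ := exists_hasCurveDegree_zariskiClosure hG hG0 hGT
  refine ⟨n, hn, ?_⟩
  obtain ⟨g, hg, hsq, hgD, hfin⟩ := hn
  have hTp := finite_tangentLines_inter hFh hF0 fun P hP hdvd =>
    F.sum_pderiv_ne_zero_of_dvd_polarForm hp hF0 hy hy' hP hdvd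
  have hline := not_projZeros_linForm_subset hg hsq hgD hfin p.rep_nonzero hTp
  have hTS : tangentLines (projZeros (F.polar p)) ⊆ projZeros g ∪
      (zariskiClosure (tangentLines (projZeros (F.polar p))) \ projZeros g) := by
    rw [Set.union_sdiff_self]
    exact (subset_zariskiClosure _).trans Set.subset_union_right
  have hcross : ∀ q, F.IsQuasiRadial q → crossProduct q.rep p.rep ≠ 0 := fun q hq h0 =>
    hqp q hq.1 (eq_of_cross_rep_eq_zero h0).symm
  have hself : eval p.rep (F.polar p) = 0 := F.eval_polarForm_self p.rep
  -- `J q` is the line `pq` as a point of the dual plane. `hcol` keeps these lines distinct, and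
  -- `htan` keeps them different from the tangent line at `p`.
  set J : P2 → P2 := fun q =>
    if h : crossProduct q.rep p.rep ≠ 0 then Projectivization.mk ℂ _ h else q with hJ
  have hJeq : ∀ q, (hq : F.IsQuasiRadial q) → J q = Projectivization.mk ℂ _ (hcross q hq) :=
    fun q hq => dif_pos (hcross q hq)
  have hinj : Set.InjOn J {q | F.IsQuasiRadial q} := by
    intro q hq q' hq' h
    rw [hJeq q hq, hJeq q' hq'] at h
    by_contra hne
    refine hcol q hq.1 q' hq'.1 hne ?_
    obtain ⟨a, ha⟩ := (Projectivization.mk_eq_mk_iff' ..).mp h.symm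
    rw [dotProduct_comm, triple_product_permutation, ← ha, dotProduct_smul, dot_self_cross,
      smul_zero]
  have hnot : Projectivization.mk ℂ _ hp ∉ J '' {q | F.IsQuasiRadial q} := by
    rintro ⟨q, hq, h⟩
    rw [hJeq q hq] at h
    obtain ⟨a, ha⟩ := (Projectivization.mk_eq_mk_iff' ..).mp h.symm
    exact htan q hq.1 (by rw [← ha, dotProduct_smul, dot_self_cross, smul_zero])
  have hB : insert (Projectivization.mk ℂ _ hp) (J '' {q | F.IsQuasiRadial q}) ⊆
      projZeros (linForm p.rep) ∩ projZeros g := by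
    rw [Set.insert_subset_iff]
    refine ⟨⟨?_, ?_⟩, ?_⟩
    · rw [mk_mem_projZeros (linForm_isHomogeneous _), eval_linForm, dot_val]
    · rw [mk_mem_projZeros hg]
      have hpy : crossProduct p.rep y ≠ 0 := by
        intro h0
        have hli := mt crossProduct_ne_zero_iff_linearIndependent.mpr (not_not.mpr h0)
        rw [LinearIndependent.pair_iff' p.rep_nonzero] at hli
        push Not at hli
        obtain ⟨a, ha⟩ := hli
        exact hy' (by rw [← ha, hFh.eval_smul, hself, mul_zero])
      refine eval_eq_zero_of_hasTransverseFactor hFh hpy hp (F.dot_val p.rep)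
        (by rwa [dotProduct_comm]) (F.hasTransverseFactor_polarForm_self p.rep y) hg hfin hTS ?_
      by_contra! h
      refine hy' (eval_eq_zero_of_forall_ne_zero (y := p.rep) fun t ht => ?_)
      have h1 : y + t • p.rep = t • (p.rep + t⁻¹ • y) := by
        rw [smul_add, smul_inv_smul₀ ht, add_comm]
      rw [h1, hFh.eval_smul, h, mul_zero]
    · rintro _ ⟨q, hq, rfl⟩
      rw [hJeq q hq]
      refine ⟨?_, ?_⟩
      · rw [mk_mem_projZeros (linForm_isHomogeneous _), eval_linForm, dot_cross_self]
      · rw [mk_mem_projZeros hg]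
        refine eval_eq_zero_of_hasTransverseFactor hFh (hcross q hq) (hcross q hq)
          (dot_self_cross _ _) (dot_cross_self _ _) (hbr q hq) hg hfin hTS ?_
        by_contra! h
        refine htan q hq.1 (F.dot_val_eq_zero_of_line fun t ht => ?_)
        have h1 : p.rep + t • q.rep = t • (q.rep + t⁻¹ • p.rep) := by
          rw [smul_add, smul_inv_smul₀ ht, add_comm]
        rw [h1, ← polar_eq, hFh.eval_smul, h, mul_zero]
  calc {q : P2 | F.IsQuasiRadial q}.encard + 1
      = (J '' {q | F.IsQuasiRadial q}).encard + 1 := by rw [hinj.encard_image]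
    _ = (insert (Projectivization.mk ℂ _ hp) (J '' {q | F.IsQuasiRadial q})).encard :=
      (Set.encard_insert_of_notMem hnot).symm
    _ ≤ n := encard_le_of_subset_line hg p.rep_nonzero hline hB

end PlaneFoliation

end

theorem mainTheorem7 (d : ℕ) (hd : 1 ≤ d) (F : PlaneFoliation d) :
    ForGeneric fun p : P2 =>
      (∀ q ∈ F.sing, p ≠ q ∧
        (¬ F.IsQuasiRadial q → tangentConeMult (F.polar p) p q = 0) ∧
        (F.IsQuasiRadial q → tangentConeMult (F.polar p) p q = 1)) ∧
      ∃ n : ℕ, HasCurveDegree (dualCurve (projZeros (F.polar p))) n ∧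
        {q : P2 | F.IsQuasiRadial q}.encard + 1 ≤ (n : ℕ∞) := by
  have hfin := F.sing_finite
  obtain ⟨i, hi⟩ := F.exists_form_ne_zero
  have h1 : ForGeneric fun p => F.val p.rep ≠ 0 :=
    ForGeneric.of_ne_zero (F.isHomogeneous i) hi fun p hp h => hp (congrFun h i)
  have h2 := ForGeneric.forall_mem_finite hfin fun q hq => F.forGeneric_tangentConeMult hq
  have h3 := ForGeneric.forall_mem_finite hfin fun q _ => F.forGeneric_polarForm_ne_zero hd q
  -- For each of the finitely many pairs of distinct singularities, `p` must avoid the line joining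
  -- them.
  have h4 := ForGeneric.forall_mem_finite (hfin.prod hfin) (P := fun s p => s.1 ≠ s.2 →
      crossProduct s.1.rep s.2.rep ⬝ᵥ p.rep ≠ 0) fun s _ => by
    by_cases hs : s.1 = s.2
    · exact ForGeneric.of_ne_zero (isHomogeneous_one _ _) one_ne_zero fun _ _ h => absurd hs h
    · exact (PlaneFoliation.forGeneric_not_collinear hs).mono fun _ h _ => h
  have h5 := F.forGeneric_exists_tangent_polar_ne_zero hd
  refine (h1.and (h2.and (h3.and (h4.and h5)))).mono ?_
  rintro p ⟨hp, hloc, htan, hcol, y, hy, hy'⟩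
  have hqp : ∀ q ∈ F.sing, p ≠ q := by
    rintro q hq rfl
    exact hp (funext hq)
  refine ⟨fun q hq => ⟨hqp q hq, (hloc q hq (hqp q hq)).1,
    fun hQR => ((hloc q hq (hqp q hq)).2 hQR).1⟩, ?_⟩
  exact F.exists_hasCurveDegree_of_general hd hp hy hy' hqp
    (fun q hq => ((hloc q hq.1 (hqp q hq.1)).2 hq).2) htan
    fun q hq q' hq' hne => hcol (q, q') ⟨hq, hq'⟩ hne
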